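/- Let $M>3$ be an integer and $G=(\mathbf{Z}/M\mathbf{Z})^\times/\{\pm1\}$. For $\gamma=\begin{pmatrix}a&b\\c&d\end{pmatrix}\in\Gamma_0(M)$ let $\langle\gamma\rangle\in G$ be the class of $d$. Let $X_1(M)=\Gamma_1(M)\backslash(\mathbf{H}\cup\mathbf{P}^1(\mathbf{Q}))$, on which $G$ acts by diamond operators ($\langle\gamma\rangle$ acts as $\Gamma_1(M)x\mapsto\Gamma_1(M)\gamma x$), let $C_0$ be the $G$-orbit of the cusp $\Gamma_1(M)\cdot 0$, and let $f:\Gamma_0(M)\to H_1(X_1(M),C_0,\mathbf{Z})$ be the map $\gamma\mapsto\{0,\gamma0\}$, where $\{0,\gamma 0\}$ is the class of the image in $X_1(M)$ of the geodesic from $0$ to $\gamma 0$. Let $T$ be a $\mathbf{Z}[G]$-module and let $u:\Gamma_0(M)\to T$ be a $1$-cocycle, i.e. $u(\gamma\gamma')=u(\gamma)+\langle\gamma\rangle u(\gamma')$ for all $\gamma,\gamma'\in\Gamma_0(M)$. Suppose that $u(-1)=0$ (i.e. that $u$ is a cocycle on $\Gamma_0(M)/\pm1$), and that $u(\gamma)=0$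 for every $\gamma\in\Gamma_1(M)$ such that $\gamma c=c$ for some $c\in\mathbf{P}^1(\mathbf{Q})$. Then $u$ factors through $f$: there is a unique $G$-equivariant group homomorphism $\tilde u:H_1(X_1(M),C_0,\mathbf{Z})\to T$ such that $\tilde u(\{0,\gamma0\})=u(\gamma)$ for all $\gamma\in\Gamma_0(M)$. -/

import Mathlib

open scoped MatrixGroups UpperHalfPlane
open Filter Topology CongruenceSubgroup

noncomputable section

/-! ## Relative singular homology in degree one

Singular chains with integer coefficients, and `H₁(X, A; ℤ)` as relative cycles modulo relative
boundaries. -/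

namespace SingularPair

section Chains

variable (X : Type*) [TopologicalSpace X]

/-- Singular `n`-simplices of `X`: continuous maps from the standard `n`-simplex. -/
abbrev Simplex (n : ℕ) : Type _ := C(stdSimplex ℝ (Fin (n + 1)), X)

/-- Singular `n`-chains with integer coefficients. -/
abbrev Chain (n : ℕ) : Type _ := Simplex X n →₀ ℤ

variable {X}

/-- The `i`-th face of a singular simplex (omitting the `i`-th vertex). -/
def face {n : ℕ} (σ : Simplex X (n + 1)) (i : Fin (n + 2)) : Simplex X n :=
  σ.comp ⟨stdSimplex.map i.succAbove, stdSimplex.continuous_map _⟩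

variable (X) in
/-- The singular boundary map `∂ σ = ∑ i, (-1) ^ i • face σ i`. -/
def boundary (n : ℕ) : Chain X (n + 1) →ₗ[ℤ] Chain X n :=
  Finsupp.linearCombination ℤ fun σ : Simplex X (n + 1) =>
    ∑ i : Fin (n + 2), (-1 : ℤ) ^ (i : ℕ) • Finsupp.single (face σ i) (1 : ℤ)

/-- The chains of `X` whose simplices all lie in the subset `A`. -/
def chainsIn (A : Set X) (n : ℕ) : Submodule ℤ (Chain X n) :=
  Finsupp.supported ℤ ℤ {σ : Simplex X n | Set.range σ ⊆ A}

/-- Relative `1`-cycles: the `1`-chains whose boundary is a chain in `A`. -/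
def relCycles (A : Set X) : Submodule ℤ (Chain X 1) :=
  (chainsIn A 0).comap (boundary X 0)

/-- Relative `1`-boundaries: sums of a `1`-chain in `A` and of the boundary of a `2`-chain. -/
def relBoundaries (A : Set X) : Submodule ℤ (Chain X 1) :=
  chainsIn A 1 ⊔ LinearMap.range (boundary X 1)

/-- The relative singular homology group `H₁(X, A; ℤ)`. -/
abbrev RelH₁ (A : Set X) : Type _ :=
  relCycles A ⧸ (relBoundaries A).comap (relCycles A).subtype

/-- The singular `1`-simplex of a path. -/
def pathSimplex {a b : X} (p : Path a b) : Simplex X 1 :=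
  p.toContinuousMap.comp
    ⟨stdSimplexHomeomorphUnitInterval, stdSimplexHomeomorphUnitInterval.continuous⟩

/-- The boundary of a `1`-simplex has two terms. -/
theorem boundary_single (σ : Simplex X 1) :
    boundary X 0 (Finsupp.single σ 1) =
      Finsupp.single (face σ 0) 1 - Finsupp.single (face σ 1) 1 := by
  simp [boundary, Fin.sum_univ_two, sub_eq_add_neg]

theorem face_pathSimplex_zero {a b : X} (p : Path a b) :
    face (pathSimplex p) 0 = ContinuousMap.const _ b := by
  ext x
  have hx : x = stdSimplex.vertex (S := ℝ) (0 : Fin 1) := Subsingleton.elim _ _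
  subst hx
  have : stdSimplex.map (S := ℝ) (Fin.succAbove (0 : Fin 2)) (stdSimplex.vertex (0 : Fin 1))
      = stdSimplex.vertex (1 : Fin 2) := by rw [stdSimplex.map_vertex]; rfl
  simp only [face, pathSimplex, ContinuousMap.comp_apply, ContinuousMap.coe_mk,
    ContinuousMap.const_apply]
  erw [this, stdSimplexHomeomorphUnitInterval_one]
  exact p.target

theorem face_pathSimplex_one {a b : X} (p : Path a b) :
    face (pathSimplex p) 1 = ContinuousMap.const _ a := by
  ext x
  have hx : x = stdSimplex.vertex (S := ℝ) (0 : Fin 1) := Subsingleton.elim _ _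
  subst hx
  have : stdSimplex.map (S := ℝ) (Fin.succAbove (1 : Fin 2)) (stdSimplex.vertex (0 : Fin 1))
      = stdSimplex.vertex (0 : Fin 2) := by rw [stdSimplex.map_vertex]; rfl
  simp only [face, pathSimplex, ContinuousMap.comp_apply, ContinuousMap.coe_mk,
    ContinuousMap.const_apply]
  erw [this, stdSimplexHomeomorphUnitInterval_zero]
  exact p.source

theorem single_pathSimplex_mem {A : Set X} {a b : X} (p : Path a b) (ha : a ∈ A) (hb : b ∈ A) :
    Finsupp.single (pathSimplex p) (1 : ℤ) ∈ relCycles A := by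
  rw [relCycles, Submodule.mem_comap]
  erw [boundary_single]
  rw [face_pathSimplex_zero, face_pathSimplex_one]
  refine Submodule.sub_mem _ ?_ ?_ <;>
    refine Finsupp.single_mem_supported ℤ _ ?_ <;>
    rintro _ ⟨y, rfl⟩ <;> simpa

/-- The class in `H₁(X, A; ℤ)` of a path with both end points in `A`. -/
def pathClass {A : Set X} {a b : X} (p : Path a b) (ha : a ∈ A) (hb : b ∈ A) : RelH₁ A :=
  Submodule.Quotient.mk ⟨Finsupp.single (pathSimplex p) 1, single_pathSimplex_mem p ha hb⟩

end Chains

section Functoriality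

variable {X Y Z : Type*} [TopologicalSpace X] [TopologicalSpace Y] [TopologicalSpace Z]

/-- The map on singular chains induced by a continuous map. -/
def chainMap (f : C(X, Y)) (n : ℕ) : Chain X n →ₗ[ℤ] Chain Y n :=
  Finsupp.lmapDomain ℤ ℤ fun σ : Simplex X n => f.comp σ

theorem boundary_chainMap (f : C(X, Y)) (n : ℕ) (c : Chain X (n + 1)) :
    boundary Y n (chainMap f (n + 1) c) = chainMap f n (boundary X n c) := by
  induction c using Finsupp.induction_linear with
  | zero => simp
  | add a b ha hb => simp only [map_add, ha, hb]
  | single σ k =>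
    simp only [boundary, chainMap, Finsupp.lmapDomain_apply, Finsupp.mapDomain_single,
      Finsupp.linearCombination_single, Finsupp.mapDomain_smul, Finsupp.mapDomain_finsetSum]
    rfl

theorem chainMap_mem_chainsIn (f : C(X, Y)) {A : Set X} {B : Set Y} (h : Set.MapsTo f A B)
    {n : ℕ} {c : Chain X n} (hc : c ∈ chainsIn A n) : chainMap f n c ∈ chainsIn B n := by
  classical
  intro τ hτ
  have := Finsupp.mapDomain_support (Finset.mem_coe.1 hτ)
  obtain ⟨σ, hσ, rfl⟩ := Finset.mem_image.1 this
  rintro _ ⟨x, rfl⟩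
  exact h (hc hσ ⟨x, rfl⟩)

theorem chainMap_mem_relCycles (f : C(X, Y)) {A : Set X} {B : Set Y} (h : Set.MapsTo f A B)
    (c : Chain X 1) (hc : c ∈ relCycles A) : chainMap f 1 c ∈ relCycles B := by
  change boundary Y 0 (chainMap f (0 + 1) c) ∈ chainsIn B 0
  rw [boundary_chainMap]
  exact chainMap_mem_chainsIn f h hc

theorem chainMap_mem_relBoundaries (f : C(X, Y)) {A : Set X} {B : Set Y} (h : Set.MapsTo f A B)
    (c : Chain X 1) (hc : c ∈ relBoundaries A) : chainMap f 1 c ∈ relBoundaries B := by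
  obtain ⟨a, ha, _, ⟨b, rfl⟩, rfl⟩ := Submodule.mem_sup.1 hc
  rw [map_add]
  refine Submodule.add_mem_sup (chainMap_mem_chainsIn f h ha) ⟨chainMap f 2 b, ?_⟩
  exact boundary_chainMap f 1 b

/-- The map `H₁(X, A; ℤ) → H₁(Y, B; ℤ)` induced by a continuous map of pairs. -/
def relMap (f : C(X, Y)) {A : Set X} {B : Set Y} (h : Set.MapsTo f A B) :
    RelH₁ A →ₗ[ℤ] RelH₁ B :=
  Submodule.mapQ _ _ ((chainMap f 1).restrict (chainMap_mem_relCycles f h))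
    fun c hc => chainMap_mem_relBoundaries f h c.1 hc

theorem relMap_id {A : Set X} (f : C(X, X)) (hf : ∀ x, f x = x) (h : Set.MapsTo f A A)
    (c : RelH₁ A) : relMap f h c = c := by
  obtain rfl : f = ContinuousMap.id X := ContinuousMap.ext hf
  induction c using Submodule.Quotient.induction_on with
  | _ c =>
    refine congrArg Submodule.Quotient.mk (Subtype.ext ?_)
    exact Finsupp.mapDomain_id

theorem relMap_comp {A : Set X} {B : Set Y} {C : Set Z} (f : C(X, Y)) (g : C(Y, Z)) (k : C(X, Z))
    (hk : ∀ x, k x = g (f x)) (hf : Set.MapsTo f A B) (hg : Set.MapsTo g B C)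
    (hk' : Set.MapsTo k A C) (c : RelH₁ A) :
    relMap k hk' c = relMap g hg (relMap f hf c) := by
  obtain rfl : k = g.comp f := ContinuousMap.ext hk
  induction c using Submodule.Quotient.induction_on with
  | _ c =>
    refine congrArg Submodule.Quotient.mk (Subtype.ext ?_)
    exact Finsupp.mapDomain_comp (v := c.1) (f := fun σ : Simplex X 1 => f.comp σ)
      (g := fun σ : Simplex Y 1 => g.comp σ)

end Functoriality

end SingularPair

/-! ## The extended upper half plane -/

/-- `ℍ ∪ ℙ¹(ℚ)`; `ℙ¹(ℚ)` is `OnePoint ℚ`, on which `GL₂(ℚ)` acts by Möbius transformations. -/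
inductive ExtendedHalfPlane : Type
  | pt (z : ℍ) : ExtendedHalfPlane
  | cusp (c : OnePoint ℚ) : ExtendedHalfPlane

namespace ExtendedHalfPlane

/-- The sets `{z | T < height c z}` are the horoballs at `c`: the half planes `T < Im z` for
`c = ∞`, and the open discs tangent to the real line at `c` for rational `c`. -/
def height (c : OnePoint ℚ) (z : ℍ) : ℝ :=
  c.elim z.im fun r => z.im / Complex.normSq ((z : ℂ) - ((r : ℝ) : ℂ))

@[simp] theorem height_infty (z : ℍ) : height OnePoint.infty z = z.im := rfl

@[simp] theorem height_coe (r : ℚ) (z : ℍ) :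
    height (r : OnePoint ℚ) z = z.im / Complex.normSq ((z : ℂ) - ((r : ℝ) : ℂ)) := rfl

/-- The horoball topology: neighbourhoods of a cusp `c` contain a horoball at `c`. -/
instance : TopologicalSpace ExtendedHalfPlane where
  IsOpen U := IsOpen {z : ℍ | pt z ∈ U} ∧
    ∀ c, cusp c ∈ U → ∃ T : ℝ, ∀ z, T < height c z → pt z ∈ U
  isOpen_univ := ⟨by simp, fun _ _ => ⟨0, fun _ _ => trivial⟩⟩
  isOpen_inter U V hU hV := ⟨hU.1.inter hV.1, fun c hc => by
    obtain ⟨S, hS⟩ := hU.2 c hc.1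
    obtain ⟨T, hT⟩ := hV.2 c hc.2
    exact ⟨max S T, fun z hz =>
      ⟨hS z (lt_of_le_of_lt (le_max_left _ _) hz), hT z (lt_of_le_of_lt (le_max_right _ _) hz)⟩⟩⟩
  isOpen_sUnion s hs := by
    refine ⟨?_, ?_⟩
    · have : {z : ℍ | pt z ∈ ⋃₀ s} = ⋃ U ∈ s, {z : ℍ | pt z ∈ U} := by ext; simp
      rw [this]
      exact isOpen_biUnion fun U hU => (hs U hU).1
    · rintro c ⟨U, hU, hc⟩
      obtain ⟨T, hT⟩ := (hs U hU).2 c hc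
      exact ⟨T, fun z hz => ⟨U, hU, hT z hz⟩⟩

theorem isOpen_iff {U : Set ExtendedHalfPlane} : IsOpen U ↔ IsOpen {z : ℍ | pt z ∈ U} ∧
    ∀ c, cusp c ∈ U → ∃ T : ℝ, ∀ z, T < height c z → pt z ∈ U := Iff.rfl

theorem continuous_pt : Continuous pt := continuous_def.2 fun _ hU => hU.1

/-- A family of points of `ℍ` whose height at a cusp tends to infinity converges to that cusp. -/
theorem tendsto_cusp {α : Type*} {l : Filter α} {f : α → ℍ} {c : OnePoint ℚ}
    (h : Tendsto (fun a => height c (f a)) l atTop) :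
    Tendsto (fun a => pt (f a)) l (𝓝 (cusp c)) := by
  rw [tendsto_nhds]
  intro U hU hc
  obtain ⟨T, hT⟩ := hU.2 c hc
  filter_upwards [h.eventually_gt_atTop T] with a ha using hT _ ha

/-- The action of `SL₂(ℤ)` by Möbius transformations. -/
instance : MulAction SL(2, ℤ) ExtendedHalfPlane where
  smul γ x := match x with
    | pt z => pt (γ • z)
    | cusp c => cusp (Matrix.SpecialLinearGroup.mapGL ℚ γ • c)
  one_smul x := by
    cases x with
    | pt z => exact congrArg pt (one_smul _ z)
    | cusp c =>
      refine congrArg cusp ?_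
      rw [map_one, one_smul]
  mul_smul γ δ x := by
    cases x with
    | pt z => exact congrArg pt (mul_smul _ _ z)
    | cusp c =>
      refine congrArg cusp ?_
      rw [map_mul, mul_smul]

theorem smul_pt (γ : SL(2, ℤ)) (z : ℍ) : γ • pt z = pt (γ • z) := rfl

theorem smul_cusp (γ : SL(2, ℤ)) (c : OnePoint ℚ) :
    γ • cusp c = cusp (Matrix.SpecialLinearGroup.mapGL ℚ γ • c) := rfl

theorem neg_smul (γ : SL(2, ℤ)) (x : ExtendedHalfPlane) : (-γ) • x = γ • x := by
  cases x with
  | pt z => rw [smul_pt, smul_pt, ModularGroup.SL_neg_smul]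
  | cusp c =>
    rw [smul_cusp, smul_cusp]
    refine congrArg cusp ?_
    cases c with
    | infty =>
      simp [OnePoint.smul_infty_eq_ite]
    | coe r =>
      simp only [OnePoint.smul_some_eq_ite, Matrix.SpecialLinearGroup.mapGL_coe_matrix,
        Matrix.SpecialLinearGroup.map_apply_coe, RingHom.mapMatrix_apply, Matrix.map_apply,
        Matrix.SpecialLinearGroup.coe_neg, Matrix.neg_apply, map_neg]
      have h (a b : ℚ) : -a * r + -b = -(a * r + b) := by ring
      simp only [h, neg_div_neg_eq, neg_eq_zero]

theorem moebius_sub_infty {a b c d z : ℂ} (h : a * d - b * c = 1) (hc : c ≠ 0)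
    (hz : c * z + d ≠ 0) : (a * z + b) / (c * z + d) - a / c = -1 / (c * (c * z + d)) := by
  rw [div_sub_div _ _ hz hc, div_eq_div_iff (mul_ne_zero hz hc) (mul_ne_zero hc hz)]
  linear_combination (-(c * (c * z + d))) * h

theorem moebius_sub_moebius {a b c d z r : ℂ} (h : a * d - b * c = 1) (hr : c * r + d ≠ 0)
    (hz : c * z + d ≠ 0) : (a * z + b) / (c * z + d) - (a * r + b) / (c * r + d) =
      (z - r) / ((c * r + d) * (c * z + d)) := by
  rw [div_sub_div _ _ hz hr, div_eq_div_iff (mul_ne_zero hz hr) (mul_ne_zero hr hz)]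
  linear_combination ((z - r) * (c * r + d) * (c * z + d)) * h

/-- Möbius transformations rescale the heights. -/
theorem height_smul (γ : SL(2, ℤ)) (c : OnePoint ℚ) :
    ∃ k : ℝ, 0 < k ∧ ∀ z : ℍ,
      height (Matrix.SpecialLinearGroup.mapGL ℚ γ • c) (γ • z) = k * height c z := by
  have hdetZ : γ 0 0 * γ 1 1 - γ 0 1 * γ 1 0 = 1 := by
    have := γ.det_coe; rwa [Matrix.det_fin_two] at this
  have hdetC : ((γ 0 0 : ℤ) : ℂ) * (γ 1 1 : ℤ) - (γ 0 1 : ℤ) * (γ 1 0 : ℤ) = 1 := by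
    exact_mod_cast hdetZ
  have hden (z : ℍ) : ((γ 1 0 : ℤ) : ℂ) * z + (γ 1 1 : ℤ) ≠ 0 := by
    simpa [UpperHalfPlane.denom] using UpperHalfPlane.denom_ne_zero γ z
  have him (z : ℍ) :
      (γ • z).im = z.im / Complex.normSq (((γ 1 0 : ℤ) : ℂ) * z + (γ 1 1 : ℤ)) := by
    simpa [UpperHalfPlane.denom] using UpperHalfPlane.im_smul_eq_div_normSq γ z
  have hco (z : ℍ) : ((γ • z : ℍ) : ℂ) = (((γ 0 0 : ℤ) : ℂ) * z + (γ 0 1 : ℤ)) /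
      (((γ 1 0 : ℤ) : ℂ) * z + (γ 1 1 : ℤ)) := by
    simpa using UpperHalfPlane.coe_specialLinearGroup_apply γ z
  have hsub (z : ℍ) (r : ℚ) : (z : ℂ) - ((r : ℝ) : ℂ) ≠ 0 := by
    intro h
    have := congrArg Complex.im h
    simp [z.im_ne_zero] at this
  cases c with
  | infty =>
    by_cases h10 : γ 1 0 = 0
    · refine ⟨1 / ((γ 1 1 : ℤ) : ℝ) ^ 2, ?_, fun z => ?_⟩
      · have : γ 1 1 ≠ 0 := by rintro h; simp [h, h10] at hdetZ
        positivity
      · rw [OnePoint.smul_infty_eq_ite]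
        simp only [Matrix.SpecialLinearGroup.mapGL_coe_matrix,
          Matrix.SpecialLinearGroup.map_apply_coe, RingHom.mapMatrix_apply, Matrix.map_apply, h10,
          map_zero, if_true, height_infty, him]
        simp [Complex.normSq_apply]
        ring
    · refine ⟨((γ 1 0 : ℤ) : ℝ) ^ 2, by positivity, fun z => ?_⟩
      have hc : ((γ 1 0 : ℤ) : ℂ) ≠ 0 := by exact_mod_cast h10
      have hcR : ((γ 1 0 : ℤ) : ℝ) ≠ 0 := by exact_mod_cast h10
      rw [OnePoint.smul_infty_eq_ite, if_neg (by simpa using h10)]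
      rw [height_coe, height_infty, him, hco]
      have : (((γ 0 0 : ℤ) : ℂ) * z + (γ 0 1 : ℤ)) / (((γ 1 0 : ℤ) : ℂ) * z + (γ 1 1 : ℤ)) -
          ((((Matrix.SpecialLinearGroup.mapGL ℚ γ) 0 0 /
            (Matrix.SpecialLinearGroup.mapGL ℚ γ) 1 0 : ℚ) : ℝ) : ℂ) =
          -1 / (((γ 1 0 : ℤ) : ℂ) * (((γ 1 0 : ℤ) : ℂ) * z + (γ 1 1 : ℤ))) := by
        simp only [Matrix.SpecialLinearGroup.mapGL_coe_matrix,
          Matrix.SpecialLinearGroup.map_apply_coe, RingHom.mapMatrix_apply, Matrix.map_apply]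
        push_cast
        simp only [eq_intCast, Rat.cast_intCast]
        exact moebius_sub_infty hdetC hc (hden z)
      rw [this]
      have h1 := Complex.normSq_pos.2 (hden z)
      simp only [map_div₀, map_mul, Complex.normSq_neg, map_one, Complex.normSq_intCast]
      field_simp
  | coe r =>
    have hr : (Matrix.SpecialLinearGroup.mapGL ℚ γ) 1 0 * r +
        (Matrix.SpecialLinearGroup.mapGL ℚ γ) 1 1 = (γ 1 0 : ℤ) * r + (γ 1 1 : ℤ) := by simp
    have hr' : (Matrix.SpecialLinearGroup.mapGL ℚ γ) 0 0 * r +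
        (Matrix.SpecialLinearGroup.mapGL ℚ γ) 0 1 = (γ 0 0 : ℤ) * r + (γ 0 1 : ℤ) := by simp
    rw [OnePoint.smul_some_eq_ite, hr, hr']
    by_cases h0 : ((γ 1 0 : ℤ) : ℚ) * r + (γ 1 1 : ℤ) = 0
    · have h10 : γ 1 0 ≠ 0 := by
        intro h
        have h11 : γ 1 1 = 0 := by simpa [h] using h0
        simp [h, h11] at hdetZ
      have h0C : ((γ 1 0 : ℤ) : ℂ) * ((r : ℝ) : ℂ) + (γ 1 1 : ℤ) = 0 := by exact_mod_cast h0
      have hcR : ((γ 1 0 : ℤ) : ℝ) ≠ 0 := by exact_mod_cast h10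
      refine ⟨1 / ((γ 1 0 : ℤ) : ℝ) ^ 2, by positivity, fun z => ?_⟩
      rw [if_pos h0, height_infty, height_coe, him]
      have : ((γ 1 0 : ℤ) : ℂ) * z + (γ 1 1 : ℤ) =
          (γ 1 0 : ℤ) * ((z : ℂ) - ((r : ℝ) : ℂ)) := by linear_combination h0C
      rw [this, map_mul, Complex.normSq_intCast]
      have := Complex.normSq_pos.2 (hsub z r)
      field_simp
    · have h0R : ((γ 1 0 : ℤ) : ℝ) * r + (γ 1 1 : ℤ) ≠ 0 := by exact_mod_cast h0
      have h0C : ((γ 1 0 : ℤ) : ℂ) * ((r : ℝ) : ℂ) + (γ 1 1 : ℤ) ≠ 0 := by exact_mod_cast h0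
      refine ⟨(((γ 1 0 : ℤ) : ℝ) * r + (γ 1 1 : ℤ)) ^ 2, by positivity, fun z => ?_⟩
      rw [if_neg h0, ← Rat.cast_id (_ / _), height_coe, height_coe, him, hco]
      have : (((γ 0 0 : ℤ) : ℂ) * z + (γ 0 1 : ℤ)) / (((γ 1 0 : ℤ) : ℂ) * z + (γ 1 1 : ℤ)) -
          (((((γ 0 0 : ℤ) * r + (γ 0 1 : ℤ)) / ((γ 1 0 : ℤ) * r + (γ 1 1 : ℤ)) : ℚ) : ℝ) : ℂ) =
          ((z : ℂ) - ((r : ℝ) : ℂ)) / ((((γ 1 0 : ℤ) : ℂ) * ((r : ℝ) : ℂ) + (γ 1 1 : ℤ)) *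
            (((γ 1 0 : ℤ) : ℂ) * z + (γ 1 1 : ℤ))) := by
        push_cast at h0C ⊢
        exact moebius_sub_moebius hdetC h0C (hden z)
      rw [Rat.cast_id, this]
      have h1 := Complex.normSq_pos.2 (hden z)
      have h2 := Complex.normSq_pos.2 (hsub z r)
      have h3 : Complex.normSq (((γ 1 0 : ℤ) : ℂ) * ((r : ℝ) : ℂ) + (γ 1 1 : ℤ)) =
          (((γ 1 0 : ℤ) : ℝ) * r + (γ 1 1 : ℤ)) ^ 2 := by
        rw [show ((γ 1 0 : ℤ) : ℂ) * ((r : ℝ) : ℂ) + (γ 1 1 : ℤ) =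
          ((((γ 1 0 : ℤ) : ℝ) * r + (γ 1 1 : ℤ) : ℝ) : ℂ) by push_cast; rfl, Complex.normSq_ofReal]
        ring
      simp only [map_div₀, map_mul, h3]
      field_simp

instance : ContinuousConstSMul SL(2, ℤ) ExtendedHalfPlane where
  continuous_const_smul γ := by
    refine continuous_def.2 fun U hU => ⟨?_, fun c hc => ?_⟩
    · exact hU.1.preimage (continuous_const_smul (γ : GL (Fin 2) ℝ) : Continuous fun z : ℍ => γ • z)
    · obtain ⟨T, hT⟩ := hU.2 _ hc
      obtain ⟨k, hk, hkz⟩ := height_smul γ c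
      refine ⟨T / k, fun z hz => hT _ ?_⟩
      rw [hkz]
      rwa [div_lt_iff₀' hk] at hz

/-! ### Geodesics between cusps -/

/-- A path between two cusps from a curve in `ℍ`, parametrized by the open unit interval, that runs
into the two cusps. -/
def pathOfCurve {α β : OnePoint ℚ} (g : ℝ → ℍ) (hg : ContinuousOn g (Set.Ioo 0 1))
    (h0 : Tendsto (fun t => height α (g t)) (𝓝[>] 0) atTop)
    (h1 : Tendsto (fun t => height β (g t)) (𝓝[<] 1) atTop) : Path (cusp α) (cusp β) where
  toFun t := if (t : ℝ) = 0 then cusp α else if (t : ℝ) = 1 then cusp β else pt (g t)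
  source' := by simp
  target' := by simp
  continuous_toFun := by
    let F : ℝ → ExtendedHalfPlane :=
      fun t => if t = 0 then cusp α else if t = 1 then cusp β else pt (g t)
    suffices h : ContinuousOn F (Set.Icc 0 1) from
      continuousOn_iff_continuous_domRestrict.1 h
    intro t ht
    rcases eq_or_lt_of_le ht.1 with rfl | ht0
    · refine (continuousWithinAt_Icc_iff_Ici zero_lt_one).2 ?_
      rw [← continuousWithinAt_Ioi_iff_Ici, ContinuousWithinAt]
      have : F 0 = cusp α := by simp [F]
      rw [this]
      refine (tendsto_cusp h0).congr' ?_
      filter_upwards [Ioo_mem_nhdsGT (zero_lt_one (α := ℝ))] with s hs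
      simp [F, hs.1.ne', hs.2.ne]
    rcases eq_or_lt_of_le ht.2 with rfl | ht1
    · refine (continuousWithinAt_Icc_iff_Iic zero_lt_one).2 ?_
      rw [← continuousWithinAt_Iio_iff_Iic, ContinuousWithinAt]
      have : F 1 = cusp β := by simp [F]
      rw [this]
      refine (tendsto_cusp h1).congr' ?_
      filter_upwards [Ioo_mem_nhdsLT (zero_lt_one (α := ℝ))] with s hs
      simp [F, hs.1.ne', hs.2.ne]
    · refine ContinuousAt.continuousWithinAt ?_
      have hn : Set.Ioo (0 : ℝ) 1 ∈ 𝓝 t := Ioo_mem_nhds ht0 ht1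
      refine ((continuous_pt.continuousAt.comp (hg.continuousAt hn))).congr ?_
      filter_upwards [hn] with s hs
      simp [F, hs.1.ne', hs.2.ne]

/-- The curve in `ℍ` with prescribed value `w t` (of positive imaginary part) for `0 < t < 1`. -/
theorem continuousOn_ofComplex {w : ℝ → ℂ} (hw : ContinuousOn w (Set.Ioo 0 1))
    (him : ∀ t ∈ Set.Ioo (0 : ℝ) 1, 0 < (w t).im) :
    ContinuousOn (fun t => UpperHalfPlane.ofComplex (w t)) (Set.Ioo 0 1) := by
  rw [UpperHalfPlane.isEmbedding_coe.continuousOn_iff]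
  refine hw.congr fun t ht => ?_
  simp [UpperHalfPlane.ofComplex_apply_of_im_pos (him t ht)]

/-- The half circle with end points `a` and `b`. -/
def halfCircle (a b : ℝ) (t : ℝ) : ℂ :=
  ⟨a + (b - a) * t ^ 2 / ((1 - t) ^ 2 + t ^ 2), |b - a| * (t * (1 - t)) / ((1 - t) ^ 2 + t ^ 2)⟩

/-- The vertical half line above `a`. -/
def verticalLine (a : ℝ) (t : ℝ) : ℂ := ⟨a, t / (1 - t)⟩

theorem den_pos (t : ℝ) : 0 < (1 - t) ^ 2 + t ^ 2 := by nlinarith [sq_nonneg (1 - 2 * t)]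

theorem halfCircle_im_pos {a b : ℝ} (hab : a ≠ b) {t : ℝ} (ht : t ∈ Set.Ioo (0 : ℝ) 1) :
    0 < (halfCircle a b t).im := by
  have h1 := den_pos t
  have h2 : 0 < |b - a| := abs_pos.2 (sub_ne_zero.2 hab.symm)
  have h3 := ht.1
  have h4 : 0 < 1 - t := by linarith [ht.2]
  simp only [halfCircle]
  positivity

theorem verticalLine_im_pos (a : ℝ) {t : ℝ} (ht : t ∈ Set.Ioo (0 : ℝ) 1) :
    0 < (verticalLine a t).im :=
  div_pos ht.1 (by linarith [ht.2])

theorem tendsto_div_self_one_sub : Tendsto (fun t : ℝ => t / (1 - t)) (𝓝[<] 1) atTop := by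
  have h : Tendsto (fun t : ℝ => 1 - t) (𝓝[<] 1) (𝓝[>] 0) := by
    refine tendsto_nhdsWithin_iff.2 ⟨?_, ?_⟩
    · refine Tendsto.mono_left ?_ nhdsWithin_le_nhds
      have : ContinuousAt (fun t : ℝ => 1 - t) 1 := by fun_prop
      simpa [ContinuousAt] using this
    · filter_upwards [self_mem_nhdsWithin] with t ht
      simpa using ht
  have h2 : Tendsto (fun t : ℝ => t) (𝓝[<] 1) (𝓝 1) := tendsto_id.mono_left nhdsWithin_le_nhds
  simpa [div_eq_mul_inv] using h2.pos_mul_atTop one_pos (tendsto_inv_nhdsGT_zero.comp h)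

theorem tendsto_one_sub_div_self : Tendsto (fun t : ℝ => (1 - t) / t) (𝓝[>] 0) atTop := by
  have h2 : Tendsto (fun t : ℝ => 1 - t) (𝓝[>] 0) (𝓝 1) := by
    refine Tendsto.mono_left ?_ nhdsWithin_le_nhds
    have : ContinuousAt (fun t : ℝ => 1 - t) 0 := by fun_prop
    simpa [ContinuousAt] using this
  simpa [div_eq_mul_inv] using h2.pos_mul_atTop one_pos tendsto_inv_nhdsGT_zero

/-- The vertical geodesic from a rational cusp to `∞`. -/
def verticalGeodesic (a : ℚ) : Path (cusp (a : OnePoint ℚ)) (cusp OnePoint.infty) :=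
  pathOfCurve (fun t => UpperHalfPlane.ofComplex (verticalLine a t))
    (continuousOn_ofComplex (by
      have h : ContinuousOn (fun t : ℝ => t / (1 - t)) (Set.Ioo 0 1) := by
        refine ContinuousOn.div (by fun_prop) (by fun_prop) fun t ht => ?_
        linarith [ht.2]
      have : verticalLine a = fun t : ℝ => ((a : ℝ) : ℂ) + ((t / (1 - t) : ℝ) : ℂ) * Complex.I := by
        funext t
        apply Complex.ext <;> simp only [verticalLine] <;> simp [-Complex.ofReal_div]
      rw [this]
      exact continuousOn_const.add
        ((Complex.continuous_ofReal.comp_continuousOn h).mul continuousOn_const))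
      fun t ht => verticalLine_im_pos _ ht)
    (by
      refine tendsto_one_sub_div_self.congr' ?_
      filter_upwards [Ioo_mem_nhdsGT (zero_lt_one (α := ℝ))] with t ht
      have h3 := ht.1.ne'
      have h4 : 1 - t ≠ 0 := by linarith [ht.2]
      rw [height_coe, UpperHalfPlane.ofComplex_apply_of_im_pos (verticalLine_im_pos _ ht)]
      simp [verticalLine, Complex.normSq_apply])
    (by
      refine tendsto_div_self_one_sub.congr' ?_
      filter_upwards [Ioo_mem_nhdsLT (zero_lt_one (α := ℝ))] with t ht
      rw [height_infty, UpperHalfPlane.ofComplex_apply_of_im_pos (verticalLine_im_pos _ ht)]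
      simp [verticalLine])

/-- The half-circle geodesic between two different rational cusps. -/
def circleGeodesic (a b : ℚ) (hab : a ≠ b) :
    Path (cusp (a : OnePoint ℚ)) (cusp (b : OnePoint ℚ)) :=
  have hR : (a : ℝ) ≠ b := by exact_mod_cast hab
  pathOfCurve (fun t => UpperHalfPlane.ofComplex (halfCircle a b t))
    (continuousOn_ofComplex (by
      have h (t : ℝ) : (1 - t) ^ 2 + t ^ 2 ≠ 0 := (den_pos t).ne'
      have : halfCircle a b = fun t : ℝ =>
          ((a + (b - a) * t ^ 2 / ((1 - t) ^ 2 + t ^ 2) : ℝ) : ℂ) +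
          ((|(b : ℝ) - a| * (t * (1 - t)) / ((1 - t) ^ 2 + t ^ 2) : ℝ) : ℂ) * Complex.I := by
        funext t
        apply Complex.ext <;> simp only [halfCircle] <;> simp [-Complex.ofReal_div]
      rw [this]
      refine Continuous.continuousOn (Continuous.add (Complex.continuous_ofReal.comp ?_)
        ((Complex.continuous_ofReal.comp ?_).mul continuous_const)) <;> fun_prop (disch := exact h _))
      fun t ht => halfCircle_im_pos hR ht)
    (by
      have hpos : 0 < |(b : ℝ) - a|⁻¹ := inv_pos.2 (abs_pos.2 (sub_ne_zero.2 hR.symm))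
      refine (tendsto_one_sub_div_self.const_mul_atTop hpos).congr' ?_
      filter_upwards [Ioo_mem_nhdsGT (zero_lt_one (α := ℝ))] with t ht
      have h1 := (den_pos t).ne'
      have h3 := ht.1.ne'
      have h4 : 1 - t ≠ 0 := by linarith [ht.2]
      have h5 : |(b : ℝ) - a| ≠ 0 := abs_ne_zero.2 (sub_ne_zero.2 hR.symm)
      have h6 : ((b : ℝ) - a) ^ 2 = |(b : ℝ) - a| ^ 2 := (sq_abs _).symm
      rw [height_coe, UpperHalfPlane.ofComplex_apply_of_im_pos (halfCircle_im_pos hR ht)]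
      have : Complex.normSq (halfCircle a b t - ((a : ℝ) : ℂ)) =
          |(b : ℝ) - a| ^ 2 * t ^ 2 / ((1 - t) ^ 2 + t ^ 2) := by
        rw [Complex.normSq_apply]
        simp only [halfCircle, Complex.sub_re, Complex.sub_im, Complex.ofReal_re,
          Complex.ofReal_im, sub_zero, add_sub_cancel_left]
        field_simp
        linear_combination (t ^ 2) * h6
      simp only [this]
      change _ = (halfCircle a b t).im / _
      simp only [halfCircle]
      field_simp)
    (by
      have hpos : 0 < |(b : ℝ) - a|⁻¹ := inv_pos.2 (abs_pos.2 (sub_ne_zero.2 hR.symm))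
      refine (tendsto_div_self_one_sub.const_mul_atTop hpos).congr' ?_
      filter_upwards [Ioo_mem_nhdsLT (zero_lt_one (α := ℝ))] with t ht
      have h1 := (den_pos t).ne'
      have h3 := ht.1.ne'
      have h4 : 1 - t ≠ 0 := by linarith [ht.2]
      have h5 : |(b : ℝ) - a| ≠ 0 := abs_ne_zero.2 (sub_ne_zero.2 hR.symm)
      have h6 : ((b : ℝ) - a) ^ 2 = |(b : ℝ) - a| ^ 2 := (sq_abs _).symm
      rw [height_coe, UpperHalfPlane.ofComplex_apply_of_im_pos (halfCircle_im_pos hR ht)]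
      have : Complex.normSq (halfCircle a b t - ((b : ℝ) : ℂ)) =
          |(b : ℝ) - a| ^ 2 * (1 - t) ^ 2 / ((1 - t) ^ 2 + t ^ 2) := by
        rw [Complex.normSq_apply]
        simp only [halfCircle, Complex.sub_re, Complex.sub_im, Complex.ofReal_re,
          Complex.ofReal_im, sub_zero]
        field_simp
        linear_combination ((1 - t) ^ 4) * h6
      simp only [this]
      change _ = (halfCircle a b t).im / _
      simp only [halfCircle]
      field_simp)

/-- The geodesic path from the cusp `α` to the cusp `β` (constant if `α = β`). -/
def geodesic : (α β : OnePoint ℚ) → Path (cusp α) (cusp β)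
  | none, none => Path.refl _
  | some a, none => verticalGeodesic a
  | none, some b => (verticalGeodesic b).symm
  | some a, some b =>
    if h : a = b then (Path.refl (cusp (some a))).cast rfl (by rw [h]) else circleGeodesic a b h

end ExtendedHalfPlane

/-! ## The modular curve `X₁(M)` and its diamond operators -/

namespace ModularCurve

open ExtendedHalfPlane SingularPair

variable (M : ℕ)

/-- The group `(ℤ/Mℤ)ˣ/{±1}`. -/
abbrev DiamondGroup : Type := (ZMod M)ˣ ⧸ Subgroup.zpowers (-1 : (ZMod M)ˣ)

/-- The map `Γ₀(M) → (ℤ/Mℤ)ˣ/{±1}` sending a matrix to its lower right entry. -/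
def diamond : Gamma0 M →* DiamondGroup M :=
  (QuotientGroup.mk' _).comp (Gamma0Map M).toHomUnits

theorem diamond_surjective : Function.Surjective (diamond M) := by
  refine (QuotientGroup.mk'_surjective _).comp fun d => ?_
  obtain ⟨D, hD⟩ := ZMod.intCast_surjective (d : ZMod M)
  have hu : IsUnit ((D : ℤ) : ZMod M) := hD ▸ d.isUnit
  obtain ⟨a, b, hab⟩ := (ZMod.coe_int_isUnit_iff_isCoprime D M).1 hu
  let γ : SL(2, ℤ) := ⟨!![b, -a; (M : ℤ), D], by
    rw [Matrix.det_fin_two_of]; linear_combination hab⟩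
  refine ⟨⟨γ, ?_⟩, Units.ext ?_⟩
  · rw [Gamma0_mem]; simp [γ]
  · change ((γ 1 1 : ℤ) : ZMod M) = d
    simpa [γ] using hD

theorem eq_or_neg_mem_Gamma1 {γ : Gamma0 M} (h : diamond M γ = 1) :
    (γ : SL(2, ℤ)) ∈ Gamma1 M ∨ -(γ : SL(2, ℤ)) ∈ Gamma1 M := by
  have key (δ : SL(2, ℤ)) (h0 : δ ∈ Gamma0 M) (h1 : ((δ 1 1 : ℤ) : ZMod M) = 1) :
      δ ∈ Gamma1 M := ⟨⟨⟨δ, h0⟩, h1⟩, trivial, rfl⟩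
  obtain ⟨n, hn⟩ := Subgroup.mem_zpowers_iff.1 ((QuotientGroup.eq_one_iff _).1 h)
  have hv : (((γ : SL(2, ℤ)) 1 1 : ℤ) : ZMod M) = (((-1 : (ZMod M)ˣ) ^ n : (ZMod M)ˣ) : ZMod M) :=
    (congrArg Units.val hn).symm
  rcases Int.even_or_odd n with hn | hn
  · left
    rw [hn.neg_one_zpow] at hv
    exact key _ γ.2 (by simpa using hv)
  · right
    rw [hn.neg_one_zpow] at hv
    refine key _ ?_ ?_
    · have := Gamma0_mem.1 γ.2
      simp [Gamma0_mem, this]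
    · simp [hv]

/-- The modular curve `X₁(M) = Γ₁(M) \ (ℍ ∪ ℙ¹(ℚ))`. -/
def X₁ : Type := MulAction.orbitRel.Quotient (Gamma1 M) ExtendedHalfPlane

instance : TopologicalSpace (X₁ M) :=
  inferInstanceAs (TopologicalSpace (Quotient (MulAction.orbitRel (Gamma1 M) ExtendedHalfPlane)))

/-- The projection `ℍ ∪ ℙ¹(ℚ) → X₁(M)`. -/
def proj (x : ExtendedHalfPlane) : X₁ M :=
  Quotient.mk (MulAction.orbitRel (Gamma1 M) ExtendedHalfPlane) x

theorem continuous_proj : Continuous (proj M) := continuous_quotient_mk'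

theorem proj_surjective : Function.Surjective (proj M) := Quotient.mk_surjective

variable {M} in
theorem proj_eq_iff {x y : ExtendedHalfPlane} :
    proj M x = proj M y ↔ ∃ γ ∈ Gamma1 M, γ • y = x := by
  refine Quotient.eq.trans ⟨?_, ?_⟩
  · rintro ⟨⟨γ, hγ⟩, h⟩
    exact ⟨γ, hγ, h⟩
  · rintro ⟨γ, hγ, h⟩
    exact ⟨⟨γ, hγ⟩, h⟩

theorem conj_mem_Gamma1 (γ : Gamma0 M) {δ : SL(2, ℤ)} (hδ : δ ∈ Gamma1 M) :
    (γ : SL(2, ℤ)) * δ * (γ : SL(2, ℤ))⁻¹ ∈ Gamma1 M := by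
  obtain ⟨⟨δ, hδ'⟩, -, rfl⟩ := hδ
  have : (Gamma1' M).Normal := MonoidHom.normal_ker _
  exact ⟨⟨γ * δ * γ⁻¹, this.conj_mem δ hδ' γ⟩, trivial, rfl⟩

/-- `Γ₀(M)` acts on `X₁(M)` since it normalizes `Γ₁(M)`. -/
instance : MulAction (Gamma0 M) (X₁ M) where
  smul γ := Quotient.lift (fun x => proj M (γ • x)) (by
    rintro x y ⟨⟨δ, hδ⟩, rfl⟩
    refine proj_eq_iff.2 ⟨_, conj_mem_Gamma1 M γ hδ, ?_⟩
    change ((γ : SL(2, ℤ)) * δ * (γ : SL(2, ℤ))⁻¹) • (γ : SL(2, ℤ)) • y = (γ : SL(2, ℤ)) • δ • y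
    simp [mul_smul])
  one_smul x := by
    obtain ⟨x, rfl⟩ := proj_surjective M x
    exact congrArg (proj M) (one_smul _ x)
  mul_smul γ δ x := by
    obtain ⟨x, rfl⟩ := proj_surjective M x
    exact congrArg (proj M) (mul_smul γ δ x)

theorem smul_proj (γ : Gamma0 M) (x : ExtendedHalfPlane) :
    γ • proj M x = proj M ((γ : SL(2, ℤ)) • x) := rfl

theorem smul_eq_of_diamond_eq_one {γ : Gamma0 M} (h : diamond M γ = 1) (x : X₁ M) : γ • x = x := by
  obtain ⟨x, rfl⟩ := proj_surjective M x
  rw [smul_proj, proj_eq_iff]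
  rcases eq_or_neg_mem_Gamma1 M h with h | h
  · exact ⟨_, h, rfl⟩
  · exact ⟨_, h, ExtendedHalfPlane.neg_smul _ _⟩

/-- The diamond operators: the action of `(ℤ/Mℤ)ˣ/{±1}` on `X₁(M)` through which the action of
`Γ₀(M)` factors (see `diamond_smul`). -/
instance : MulAction (DiamondGroup M) (X₁ M) :=
  MulAction.compHom (X₁ M) ((diamond M).liftOfSurjective (diamond_surjective M)
    ⟨MulAction.toPermHom (Gamma0 M) (X₁ M), fun _ hγ =>
      Equiv.ext fun x => smul_eq_of_diamond_eq_one M hγ x⟩)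

theorem diamond_smul (γ : Gamma0 M) (x : X₁ M) : diamond M γ • x = γ • x :=
  Equiv.congr_fun ((diamond M).liftOfRightInverse_comp_apply _
    (Function.rightInverse_surjInv (diamond_surjective M))
    ⟨MulAction.toPermHom (Gamma0 M) (X₁ M), fun _ hγ =>
      Equiv.ext fun x => smul_eq_of_diamond_eq_one M hγ x⟩ γ) x

instance : ContinuousConstSMul (DiamondGroup M) (X₁ M) where
  continuous_const_smul g := by
    obtain ⟨γ, rfl⟩ := diamond_surjective M g
    simp only [diamond_smul]
    exact Continuous.quotient_lift
      ((continuous_proj M).comp (continuous_const_smul (γ : SL(2, ℤ)))) _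

/-- The set `C₀` of cusps of `X₁(M)` in the diamond orbit of the cusp `Γ₁(M) · 0`. -/
def C₀ : Set (X₁ M) :=
  MulAction.orbit (DiamondGroup M) (proj M (cusp ((0 : ℚ) : OnePoint ℚ)))

/-- The relative homology group `H₁(X₁(M), C₀, ℤ)`. -/
abbrev H₁ : Type := RelH₁ (C₀ M)

theorem mapsTo_C₀ (g : DiamondGroup M) :
    Set.MapsTo (⟨fun x => g • x, continuous_const_smul g⟩ : C(X₁ M, X₁ M)) (C₀ M) (C₀ M) :=
  fun _ hx => MulAction.mem_orbit_of_mem_orbit g hx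

/-- The diamond operators on `H₁(X₁(M), C₀, ℤ)`. -/
instance : DistribMulAction (DiamondGroup M) (H₁ M) where
  smul g := relMap ⟨fun x => g • x, continuous_const_smul g⟩ (mapsTo_C₀ M g)
  one_smul := relMap_id _ (fun x => one_smul _ x) _
  mul_smul g h := relMap_comp _ _ _ (fun x => mul_smul g h x) _ _ _
  smul_zero _ := map_zero _
  smul_add _ := map_add _

theorem proj_smul_zero_mem (γ : Gamma0 M) :
    proj M (cusp (Matrix.SpecialLinearGroup.mapGL ℚ (γ : SL(2, ℤ)) • ((0 : ℚ) : OnePoint ℚ)))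
      ∈ C₀ M :=
  ⟨diamond M γ, diamond_smul M γ _⟩

/-- The map `f : Γ₀(M) → H₁(X₁(M), C₀, ℤ)`, `γ ↦ {0, γ0}`: the class of the image in `X₁(M)` of the
geodesic from `0` to `γ0`. -/
def zeroSymbol (γ : Gamma0 M) : H₁ M :=
  pathClass ((geodesic ((0 : ℚ) : OnePoint ℚ)
      (Matrix.SpecialLinearGroup.mapGL ℚ (γ : SL(2, ℤ)) • ((0 : ℚ) : OnePoint ℚ))).map
        (continuous_proj M))
    (MulAction.mem_orbit_self _) (proj_smul_zero_mem M γ)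

end ModularCurve

end

/-! Uniqueness says that the symbols `{0, γ0}` generate the homology group (`span_zeroSymbol`).
Existence is proved by writing down a cochain, not by presenting the group by generators and
relations.

Generation. Vertical lines contract `ℍ ∪ ℙ¹(ℚ)` to `∞` (`continuous_cone`), so modulo boundaries the
image of a curve in `ℍ ∪ ℙ¹(ℚ)` depends only on its end points (`cls_proj_curve`). A curve in
`X₁(M)` need not be lifted as a whole. Every point of `ℍ ∪ ℙ¹(ℚ)` has a good neighbourhood `U`
(`exists_isGood`): an element of `Γ₁(M)` identifying two points of `U` fixes a cusp and respects a
contraction of `U` to a cusp. The contraction therefore descends to the image of `U`, and a short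
curve there is a difference of two descending curves (`IsGood.exists_cls_eq`). Connectedness of the
real line passes from short curves to all curves (`cls_sub_mem`), up to classes `{0, δ0}` with `δ ∈
Γ₁(M)`.

Existence. On `Γ₁(M)` the cocycle is a homomorphism, and it kills stabilizers because these fix
cusps. Hence some function `h` on `ℍ ∪ ℙ¹(ℚ)`, with no continuity required, satisfies `h(δy) = u(δ)
+ h(y)` for `δ ∈ Γ₁(M)` and `h(γ0) = u(γ)` (`exists_translated`). As `u` also kills identifications
inside good sets, `h` descends to their images, and the local functions differ by locally constant
ones. They play the part of local primitives of a closed form with values in `T`: integrating along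
singular simplices kills boundaries, and kills chains in `C₀` because a good set contains at most
one cusp (`homOnRelH₁`). On `{0, γ0}` the integral is `h(γ0) - h(0) = u(γ)`.

The hypothesis `M > 3` excludes elliptic elements: a trace congruent to 2 modulo `M` whose square is
less than 5 must be `±2`. -/

noncomputable section

/-! ### Homomorphisms on relative homology from local primitives. -/

namespace SingularPair

/-- The boundary of a `2`-simplex has three terms. -/
theorem boundary_single_two {X : Type*} [TopologicalSpace X] (σ : Simplex X 2) :
    boundary X 1 (Finsupp.single σ 1) = Finsupp.single (face σ 0) 1 - Finsupp.single (face σ 1) 1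
      + Finsupp.single (face σ 2) 1 := by
  rw [boundary, Finsupp.linearCombination_single, one_smul]
  refine (Fin.sum_univ_three _).trans ?_
  simp [sub_eq_add_neg]

section Primitives

variable {X ι T : Type*} [TopologicalSpace X] [AddCommGroup T]

/-- Functions `h i` on the members `V i` of an open cover that differ by locally constant functions
on the overlaps. -/
structure LocalPrimitives (X ι T : Type*) [TopologicalSpace X] [AddCommGroup T] where
  V : ι → Set X
  isOpen : ∀ i, IsOpen (V i)
  index : X → ι
  mem_index : ∀ x, x ∈ V (index x)
  h : ι → X → T
  locConst : ∀ i j x, x ∈ V i → x ∈ V j → ∀ᶠ y in 𝓝 x, h i y - h j y = h i x - h j x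

namespace LocalPrimitives

variable (P : LocalPrimitives X ι T)

/-- `g` is a primitive along `F` if it differs from each `h i ∘ F` by a locally constant
function. -/
def IsPrimitive {Z : Type*} [TopologicalSpace Z] (F : Z → X) (g : Z → T) : Prop :=
  ∀ i z, F z ∈ P.V i → ∀ᶠ w in 𝓝 z, g w - P.h i (F w) = g z - P.h i (F z)

/-- The principal bundle with discrete fibre `T` defined by the differences `h i - h j`. -/
def core : letI : TopologicalSpace T := ⊥; FiberBundleCore ι X T :=
  letI : TopologicalSpace T := ⊥
  haveI : DiscreteTopology T := ⟨rfl⟩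
  { baseSet := P.V
    isOpen_baseSet := P.isOpen
    indexAt := P.index
    mem_baseSet_at := P.mem_index
    coordChange := fun i j x t => t + P.h i x - P.h j x
    coordChange_self := fun i x _ v => by abel
    continuousOn_coordChange := fun i j => by
      rintro ⟨x, t⟩ ⟨⟨hi, hj⟩, -⟩
      refine ContinuousAt.continuousWithinAt ?_
      rw [ContinuousAt, nhds_discrete T, tendsto_pure, nhds_prod_eq, nhds_discrete T]
      filter_upwards [(P.locConst i j x hi hj).prod_mk (eventually_pure.2 rfl :
        ∀ᶠ s in pure t, s = t)] with p hp
      rw [hp.2, add_sub_assoc, hp.1, add_sub_assoc]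
    coordChange_comp := fun i j k x _ v => by abel }

/-- The bundle `core` has discrete fibres, so its projection is a covering and `F` lifts to it from
a simply connected space. The fibre coordinate of the lift is, up to the local function of the
chart, the primitive. -/
theorem exists_isPrimitive {Z : Type*} [TopologicalSpace Z] [SimplyConnectedSpace Z]
    [LocallyPathConnectedSpace Z] (F : C(Z, X)) : ∃ g : Z → T, P.IsPrimitive F g := by
  let : TopologicalSpace T := ⊥
  have : DiscreteTopology T := ⟨rfl⟩
  obtain ⟨z₀⟩ : Nonempty Z := inferInstance
  have hcov : IsCoveringMap (Bundle.TotalSpace.proj : P.core.TotalSpace → X) :=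
    FiberBundle.isCoveringMap
  obtain ⟨G, ⟨-, hG⟩, -⟩ := hcov.existsUnique_continuousMap_lifts F z₀
    (⟨F z₀, (0 : T)⟩ : P.core.TotalSpace) rfl
  have hG' (z : Z) : (G z).1 = F z := congrFun hG z
  let v (z : Z) : T := (G z).2
  -- The coordinate changes make `t + h i x` independent of the chart `i`. In the fixed chart `i`
  -- the coordinate of the lift is thus `g - h i ∘ F`, and it is locally constant because the fibre
  -- is discrete.
  refine ⟨fun z => v z + P.h (P.index (F z)) (F z), fun i z hz => ?_⟩
  have hc : ContinuousAt (fun w => (P.core.localTriv i (G w)).2) z := by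
    refine continuous_snd.continuousAt.comp (ContinuousAt.comp ?_ G.continuous.continuousAt)
    refine (P.core.localTriv i).continuousAt ?_
    rw [FiberBundleCore.mem_localTriv_source, hG']
    exact hz
  rw [ContinuousAt, nhds_discrete T, tendsto_pure] at hc
  have key (w : Z) : (P.core.localTriv i (G w)).2 =
      v w + P.h (P.index (F w)) (F w) - P.h i (F w) := by
    rw [← hG' w]; rfl
  filter_upwards [hc] with w hw
  rw [key, key] at hw
  exact hw

variable {P}

theorem IsPrimitive.comp {Z W : Type*} [TopologicalSpace Z] [TopologicalSpace W] {F : Z → X}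
    {g : Z → T} (hg : P.IsPrimitive F g) {k : W → Z} (hk : Continuous k) :
    P.IsPrimitive (F ∘ k) (g ∘ k) :=
  fun i w hw => hk.continuousAt.eventually (hg i (k w) hw)

theorem IsPrimitive.sub_eq {Z : Type*} [TopologicalSpace Z] [PreconnectedSpace Z] {F : Z → X}
    {g g' : Z → T} (hg : P.IsPrimitive F g) (hg' : P.IsPrimitive F g')
    (z w : Z) : g z - g w = g' z - g' w := by
  have : IsLocallyConstant fun z => g z - g' z := by
    rw [IsLocallyConstant.iff_eventually_eq]
    intro z
    filter_upwards [hg _ z (P.mem_index (F z)), hg' _ z (P.mem_index (F z))] with w h1 h2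
    have := congrArg₂ (· - ·) h1 h2
    simpa using this
  have := this.apply_eq_of_preconnectedSpace z w
  rw [sub_eq_sub_iff_add_eq_add] at this ⊢
  rw [this, add_comm]

instance (n : ℕ) : ContractibleSpace (stdSimplex ℝ (Fin (n + 1))) :=
  (convex_stdSimplex ℝ _).contractibleSpace ⟨_, (stdSimplex.vertex 0).2⟩

instance (n : ℕ) : LocallyPathConnectedSpace (stdSimplex ℝ (Fin (n + 1))) :=
  (convex_stdSimplex ℝ _).locallyPathConnectedSpace

variable (P) in
/-- The increment along a singular `1`-simplex of a primitive. -/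
def increment (σ : Simplex X 1) : T :=
  (P.exists_isPrimitive σ).choose (stdSimplex.vertex 1) -
    (P.exists_isPrimitive σ).choose (stdSimplex.vertex 0)

theorem IsPrimitive.increment_eq {σ : Simplex X 1} {g} (hg : P.IsPrimitive σ g) :
    P.increment σ = g (stdSimplex.vertex 1) - g (stdSimplex.vertex 0) :=
  (P.exists_isPrimitive σ).choose_spec.sub_eq hg _ _

variable (P) in
/-- The singular cochain given by the increments of primitives. -/
def cochain : Chain X 1 →ₗ[ℤ] T := Finsupp.linearCombination ℤ P.increment

theorem cochain_single (σ : Simplex X 1) : P.cochain (Finsupp.single σ 1) = P.increment σ := by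
  simp [cochain]

/-- A primitive on the whole `2`-simplex restricts to primitives on the three faces, so the
increments cancel vertex by vertex. -/
theorem cochain_boundary (c : Chain X 2) : P.cochain (boundary X 1 c) = 0 := by
  induction c using Finsupp.induction_linear with
  | zero => simp
  | add a b ha hb => rw [map_add, map_add, ha, hb, add_zero]
  | single σ k =>
    obtain ⟨g, hg⟩ := P.exists_isPrimitive σ
    have hface (i : Fin 3) : P.increment (face σ i) =
        g (stdSimplex.vertex (i.succAbove 1)) - g (stdSimplex.vertex (i.succAbove 0)) := by
      rw [IsPrimitive.increment_eq (hg.comp (stdSimplex.continuous_map i.succAbove))]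
      simp only [Function.comp_apply, stdSimplex.map_vertex]
    have hk : (Finsupp.single σ k : Chain X 2) = k • Finsupp.single σ 1 := by simp
    rw [hk, map_smul, boundary_single_two, map_smul, map_add, map_sub, cochain_single,
      cochain_single, cochain_single, hface, hface, hface]
    have h (x y z : T) : z - y - (z - x) + (y - x) = 0 := by abel
    exact (congrArg (k • ·) (h _ _ _)).trans (smul_zero k)

/-- A simplex inside `A` is locally constant, since each open set of the cover meets `A` in at most
one point. Hence the zero function is a primitive along it. -/
theorem cochain_eq_zero_of_mem_chainsIn {A : Set X}
    (hA : ∀ i, (P.V i ∩ A).Subsingleton) {c : Chain X 1} (hc : c ∈ chainsIn A 1) :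
    P.cochain c = 0 := by
  rw [cochain, Finsupp.linearCombination_apply]
  refine Finset.sum_eq_zero fun σ hσ => ?_
  have hσA : Set.range σ ⊆ A := hc hσ
  have : P.IsPrimitive σ (fun _ => 0) := by
    intro i z hz
    filter_upwards [σ.continuous.continuousAt.eventually ((P.isOpen i).mem_nhds hz)] with w hw
    rw [hA i ⟨hw, hσA ⟨w, rfl⟩⟩ ⟨hz, hσA ⟨z, rfl⟩⟩]
  change c σ • P.increment σ = 0
  rw [this.increment_eq, sub_self, smul_zero]

variable (P) in
/-- The homomorphism `H₁(X, A; ℤ) → T` given by the increments of primitives. -/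
def homOnRelH₁ {A : Set X} (hA : ∀ i, (P.V i ∩ A).Subsingleton) : RelH₁ A →ₗ[ℤ] T :=
  Submodule.liftQ _ (P.cochain ∘ₗ (relCycles A).subtype) (by
    intro c hc
    obtain ⟨a, ha, _, ⟨b, rfl⟩, h⟩ := Submodule.mem_sup.1 hc
    rw [LinearMap.mem_ker]
    change P.cochain ((relCycles A).subtype c) = 0
    rw [← h, map_add, cochain_boundary, cochain_eq_zero_of_mem_chainsIn hA ha, add_zero])

theorem homOnRelH₁_pathClass {A : Set X} (hA : ∀ i, (P.V i ∩ A).Subsingleton) {a b : X}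
    (p : Path a b) (ha : a ∈ A) (hb : b ∈ A) {g : unitInterval → T} (hg : P.IsPrimitive p g) :
    P.homOnRelH₁ hA (pathClass p ha hb) = g 1 - g 0 := by
  change P.cochain (Finsupp.single (pathSimplex p) 1) = _
  rw [cochain_single, IsPrimitive.increment_eq (P := P) (σ := pathSimplex p)
    (hg.comp stdSimplexHomeomorphUnitInterval.continuous)]
  rfl

end LocalPrimitives

end Primitives

end SingularPair

/-! ### Singular 1-chains modulo boundaries. -/

namespace SingularPair

section AffineSimplices

variable {X E : Type*} [TopologicalSpace X]
  [AddCommGroup E] [Module ℝ E] [TopologicalSpace E] [ContinuousAdd E] [ContinuousSMul ℝ E]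

/-- The singular simplex obtained from a map `F` on a vector space by restriction to the affine
simplex with vertices `p i`. -/
def affineSimplex (F : C(E, X)) {n : ℕ} (p : Fin (n + 1) → E) : Simplex X n where
  toFun x := F (∑ i, x i • p i)
  continuous_toFun := by
    refine F.continuous.comp (continuous_finsetSum _ fun i _ => Continuous.smul ?_ continuous_const)
    exact (continuous_apply i).comp continuous_subtype_val

theorem face_affineSimplex (F : C(E, X)) {n : ℕ} (p : Fin (n + 2) → E) (i : Fin (n + 2)) :
    face (affineSimplex F p) i = affineSimplex F (p ∘ i.succAbove) := by
  ext x
  refine congrArg F ?_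
  simp only [ContinuousMap.coe_mk, stdSimplex.map_coe, Function.comp_apply,
    FunOnFinite.linearMap_apply_apply, Finset.sum_smul]
  rw [Finset.sum_comm' (t' := Finset.univ) (s' := fun j => {i.succAbove j}) (by simp [eq_comm])]
  simp

theorem affineSimplex_pair (F : C(E, X)) (a b : E) (x : stdSimplex ℝ (Fin 2)) :
    affineSimplex F ![a, b] x = F (x 0 • a + x 1 • b) :=
  congrArg F (Fin.sum_univ_two _)

variable (X) in
/-- Singular `1`-chains modulo boundaries. -/
abbrev ChainClass : Type _ := Chain X 1 ⧸ LinearMap.range (boundary X 1)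

/-- The class of a singular `1`-simplex modulo boundaries. -/
def cls (σ : Simplex X 1) : ChainClass X := Submodule.Quotient.mk (Finsupp.single σ 1)

theorem cls_face (σ : Simplex X 2) : cls (face σ 0) + cls (face σ 2) = cls (face σ 1) := by
  rw [← sub_eq_zero]
  refine ((Submodule.Quotient.mk_eq_zero _).2 ⟨Finsupp.single σ 1, ?_⟩ :
    Submodule.Quotient.mk (Finsupp.single (face σ 0) (1 : ℤ) + Finsupp.single (face σ 2) 1 -
      Finsupp.single (face σ 1) 1) = (0 : ChainClass X))
  rw [boundary_single_two]
  abel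

theorem cls_affineSimplex_add (F : C(E, X)) (a b c : E) :
    cls (affineSimplex F ![a, b]) + cls (affineSimplex F ![b, c]) =
      cls (affineSimplex F ![a, c]) := by
  have h := cls_face (affineSimplex F ![a, b, c])
  rw [face_affineSimplex, face_affineSimplex, face_affineSimplex] at h
  have h0 : ![a, b, c] ∘ Fin.succAbove (0 : Fin 3) = ![b, c] := by
    ext i; fin_cases i <;> rfl
  have h1 : ![a, b, c] ∘ Fin.succAbove (1 : Fin 3) = ![a, c] := by
    ext i; fin_cases i <;> rfl
  have h2 : ![a, b, c] ∘ Fin.succAbove (2 : Fin 3) = ![a, b] := by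
    ext i; fin_cases i <;> rfl
  rw [← h0, ← h1, ← h2, ← h, add_comm]

/-- The singular simplex of a curve parametrized by the unit interval. -/
def curveSimplex (p : C(unitInterval, X)) : Simplex X 1 :=
  p.comp ⟨stdSimplexHomeomorphUnitInterval, stdSimplexHomeomorphUnitInterval.continuous⟩

theorem cls_curveSimplex_const (x : X) : cls (curveSimplex (ContinuousMap.const _ x)) = 0 := by
  -- A constant triangle gives `c + c = c`.
  have h := cls_affineSimplex_add (ContinuousMap.const ℝ x) 0 0 0
  rwa [add_eq_left] at h

/-- The restriction of a curve to the interval from `a` to `b`, parametrized by `[0, 1]`. -/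
def subcurve (F : C(ℝ, X)) (a b : ℝ) : C(unitInterval, X) :=
  ⟨fun s => F (a + s * (b - a)), by fun_prop⟩

theorem curveSimplex_subcurve (F : C(ℝ, X)) (a b : ℝ) :
    curveSimplex (subcurve F a b) = affineSimplex F ![a, b] := by
  ext x
  refine congrArg F ?_
  have h := stdSimplex.add_eq_one x
  change a + x 1 * (b - a) = _
  rw [Fin.sum_univ_two]
  simp only [Matrix.cons_val_zero, Matrix.cons_val_one, smul_eq_mul]
  linear_combination (-a) * h

theorem cls_subcurve_add (F : C(ℝ, X)) (a b c : ℝ) :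
    cls (curveSimplex (subcurve F a b)) + cls (curveSimplex (subcurve F b c)) =
      cls (curveSimplex (subcurve F a c)) := by
  simp only [curveSimplex_subcurve, cls_affineSimplex_add]

/-- The extension of a singular `1`-simplex to a curve on the real line, constant outside the unit
interval. -/
def extendCurve (σ : Simplex X 1) : C(ℝ, X) :=
  ⟨fun t => σ (stdSimplexHomeomorphUnitInterval.symm (Set.projIcc 0 1 zero_le_one t)),
    σ.continuous.comp (stdSimplexHomeomorphUnitInterval.symm.continuous.comp continuous_projIcc)⟩

theorem curveSimplex_subcurve_extendCurve (σ : Simplex X 1) :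
    curveSimplex (subcurve (extendCurve σ) 0 1) = σ := by
  ext x
  refine congrArg σ ?_
  rw [Homeomorph.symm_apply_eq]
  change Set.projIcc (0 : ℝ) 1 zero_le_one
    (0 + ((stdSimplexHomeomorphUnitInterval x : unitInterval) : ℝ) * (1 - 0)) = _
  rw [sub_zero, mul_one, zero_add]
  exact Set.projIcc_val _ _

theorem extendCurve_zero (σ : Simplex X 1) : extendCurve σ 0 = σ (stdSimplex.vertex 0) := by
  refine congrArg σ ?_
  rw [Homeomorph.symm_apply_eq, Set.projIcc_left]
  rfl

theorem extendCurve_one (σ : Simplex X 1) : extendCurve σ 1 = σ (stdSimplex.vertex 1) := by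
  refine congrArg σ ?_
  rw [Homeomorph.symm_apply_eq, Set.projIcc_right]
  rfl

/-- The two ways around a square are homologous. -/
theorem cls_square (G : C(unitInterval × unitInterval, X)) :
    cls (curveSimplex (G.comp ((ContinuousMap.id _).prodMk (.const _ 0)))) +
      cls (curveSimplex (G.comp (.prodMk (.const _ 1) (.id _)))) =
    cls (curveSimplex (G.comp (.prodMk (.const _ 0) (.id _)))) +
      cls (curveSimplex (G.comp ((ContinuousMap.id _).prodMk (.const _ 1)))) := by
  -- Clamping both coordinates extends `G` to the vector space `ℝ × ℝ`. There the four sides are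
  -- affine simplices, and each way around equals the diagonal from `(0, 0)` to `(1, 1)`.
  let pr : C(ℝ, unitInterval) := ⟨Set.projIcc 0 1 zero_le_one, continuous_projIcc⟩
  let F : C(ℝ × ℝ, X) := G.comp (pr.prodMap pr)
  have key (a b : ℝ × ℝ) (p : C(unitInterval, unitInterval × unitInterval))
      (hp : ∀ s : unitInterval, p s =
        (pr ((1 - (s : ℝ)) * a.1 + s * b.1), pr ((1 - (s : ℝ)) * a.2 + s * b.2))) :
      curveSimplex (G.comp p) = affineSimplex F ![a, b] := by
    ext x
    have h := stdSimplex.add_eq_one x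
    rw [affineSimplex_pair]
    let t : unitInterval := stdSimplexHomeomorphUnitInterval x
    change G (p t) = G (pr (x 0 * a.1 + x 1 * b.1), pr (x 0 * a.2 + x 1 * b.2))
    have ht : x 1 = t := rfl
    rw [hp, ht, show x 0 = 1 - (t : ℝ) from eq_sub_of_add_eq h]
  have hpr (s : unitInterval) : pr s = s := Set.projIcc_val zero_le_one _
  have hpr0 : pr 0 = 0 := Set.projIcc_left zero_le_one
  have hpr1 : pr 1 = 1 := Set.projIcc_right zero_le_one
  have h1 := key (0, 0) (1, 0) ((ContinuousMap.id _).prodMk (.const _ 0)) fun s => by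
    simp [hpr, hpr0]
  have h2 := key (1, 0) (1, 1) (.prodMk (.const _ 1) (.id _)) fun s => by simp [hpr, hpr1]
  have h3 := key (0, 0) (0, 1) (.prodMk (.const _ 0) (.id _)) fun s => by simp [hpr, hpr0]
  have h4 := key (0, 1) (1, 1) ((ContinuousMap.id _).prodMk (.const _ 1)) fun s => by
    simp [hpr, hpr1]
  rw [h1, h2, h3, h4, cls_affineSimplex_add, cls_affineSimplex_add]

end AffineSimplices

end SingularPair

/-! ### Topology of the extended half plane and its contraction to the cusp `∞`. -/

namespace ExtendedHalfPlane

/-! ### Neighbourhoods in the extended upper half plane -/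

theorem pt_injective : Function.Injective pt := fun _ _ h => by injection h

theorem isOpenEmbedding_pt : IsOpenEmbedding pt := by
  refine .of_continuous_injective_isOpenMap continuous_pt pt_injective fun O hO => ?_
  refine isOpen_iff.2 ⟨?_, ?_⟩
  · convert hO using 1
    ext z
    exact pt_injective.mem_set_image
  · rintro c ⟨z, -, h⟩
    cases h

theorem continuous_height (c : OnePoint ℚ) : Continuous (height c) := by
  cases c with
  | infty => exact UpperHalfPlane.continuous_im
  | coe r =>
    refine Continuous.div UpperHalfPlane.continuous_im (Complex.continuous_normSq.comp
      (UpperHalfPlane.continuous_coe.sub continuous_const)) fun z h => ?_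
    have := congrArg Complex.im (Complex.normSq_eq_zero.1 h)
    simp [z.im_ne_zero] at this

/-- The open horoball of a cusp, with the cusp added. -/
def horoball (c : OnePoint ℚ) (T : ℝ) : Set ExtendedHalfPlane :=
  insert (cusp c) (pt '' {z | T < height c z})

theorem isOpen_horoball (c : OnePoint ℚ) (T : ℝ) : IsOpen (horoball c T) := by
  refine isOpen_iff.2 ⟨?_, ?_⟩
  · have : {z : ℍ | pt z ∈ horoball c T} = {z | T < height c z} := by
      ext z
      simp [horoball, pt_injective.eq_iff]
    rw [this]
    exact isOpen_lt continuous_const (continuous_height c)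
  · rintro c' (h | ⟨z, -, h⟩)
    · injection h with h
      subst h
      exact ⟨T, fun z hz => Or.inr ⟨z, hz, rfl⟩⟩
    · cases h

theorem horoball_mem_nhds (c : OnePoint ℚ) (T : ℝ) : horoball c T ∈ 𝓝 (cusp c) :=
  (isOpen_horoball c T).mem_nhds (Set.mem_insert _ _)

theorem tendsto_cusp_of_horoball {α : Type*} {l : Filter α} {f : α → ExtendedHalfPlane}
    {c : OnePoint ℚ} (h : ∀ T, 0 < T → ∀ᶠ a in l, f a ∈ horoball c T) :
    Tendsto f l (𝓝 (cusp c)) := by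
  rw [tendsto_nhds]
  intro U hU hc
  obtain ⟨T, hT⟩ := hU.2 c hc
  filter_upwards [h (max T 1) (by positivity)] with a ha
  rcases ha with ha | ⟨z, hz, ha⟩
  · rw [Set.mem_preimage, ha]
    exact hc
  · rw [Set.mem_preimage, ← ha]
    exact hT z (lt_of_le_of_lt (le_max_left _ _) hz)

/-! ### The contraction to the cusp `∞` -/

/-- The position in `ℂ` of a point different from the cusp `∞`. -/
def position : ExtendedHalfPlane → ℂ
  | pt z => z
  | cusp c => c.elim 0 fun r => ((r : ℝ) : ℂ)

@[simp] theorem position_pt (z : ℍ) : position (pt z) = z := rfl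

@[simp] theorem position_coe (r : ℚ) : position (cusp (r : OnePoint ℚ)) = ((r : ℝ) : ℂ) := rfl

theorem position_im_nonneg (y : ExtendedHalfPlane) : 0 ≤ (position y).im := by
  cases y with
  | pt z => exact z.im_pos.le
  | cusp c =>
    cases c with
    | infty => exact le_rfl
    | coe r => simp

/-- At a rational cusp `r`, the horoball of height `1 / ε` gives `|z - r|² < ε Im z ≤ ε |z - r|`, so
`|z - r| < ε`. -/
theorem continuousAt_position {y : ExtendedHalfPlane} (hy : y ≠ cusp OnePoint.infty) :
    ContinuousAt position y := by
  cases y with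
  | pt z =>
    rw [← isOpenEmbedding_pt.continuousAt_iff]
    exact UpperHalfPlane.continuous_coe.continuousAt
  | cusp c =>
    cases c with
    | infty => exact absurd rfl hy
    | coe r =>
      rw [Metric.continuousAt_iff']
      intro ε hε
      filter_upwards [horoball_mem_nhds (r : OnePoint ℚ) (1 / ε)] with y hy
      rcases hy with rfl | ⟨z, hz, rfl⟩
      · simpa using hε
      · rw [position_pt, position_coe, Complex.dist_eq]
        change 1 / ε < z.im / Complex.normSq ((z : ℂ) - ((r : ℝ) : ℂ)) at hz
        have h1 : z.im ≤ ‖(z : ℂ) - ((r : ℝ) : ℂ)‖ := by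
          have := Complex.abs_im_le_norm ((z : ℂ) - ((r : ℝ) : ℂ))
          simp only [Complex.sub_im, Complex.ofReal_im, sub_zero] at this
          exact (le_abs_self _).trans this
        have h2 := z.im_pos
        have h3 : 0 < ‖(z : ℂ) - ((r : ℝ) : ℂ)‖ := h2.trans_le h1
        rw [Complex.normSq_eq_norm_sq, div_lt_div_iff₀ hε (by positivity)] at hz
        nlinarith

/-- The endpoint of the vertical segment that starts at `y` and whose length corresponds to
`s ∈ [0, 1]`. -/
def shifted (y : ExtendedHalfPlane) (s : unitInterval) : ℂ :=
  position y + ((s / (1 - s) : ℝ) : ℂ) * Complex.I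

theorem shifted_re (y : ExtendedHalfPlane) (s : unitInterval) :
    (shifted y s).re = (position y).re := by
  rw [shifted, Complex.add_re, Complex.re_ofReal_mul]
  simp

theorem shifted_im (y : ExtendedHalfPlane) (s : unitInterval) :
    (shifted y s).im = (position y).im + s / (1 - s) := by
  rw [shifted, Complex.add_im, Complex.im_ofReal_mul]
  simp

theorem ratio_nonneg (s : unitInterval) : 0 ≤ (s : ℝ) / (1 - s) :=
  div_nonneg s.2.1 (by linarith [s.2.2])

open Classical in
/-- The vertical contraction of `ℍ ∪ ℙ¹(ℚ)` to the cusp `∞`. -/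
def cone (y : ExtendedHalfPlane) (s : unitInterval) : ExtendedHalfPlane :=
  if y = cusp OnePoint.infty ∨ s = 1 then cusp OnePoint.infty
  else if 0 < (shifted y s).im then pt (UpperHalfPlane.ofComplex (shifted y s))
  else y

theorem cone_infty (s : unitInterval) : cone (cusp OnePoint.infty) s = cusp OnePoint.infty :=
  if_pos (Or.inl rfl)

theorem cone_one (y : ExtendedHalfPlane) : cone y 1 = cusp OnePoint.infty :=
  if_pos (Or.inr rfl)

theorem cone_of_im_pos {y : ExtendedHalfPlane} {s : unitInterval} (hy : y ≠ cusp OnePoint.infty)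
    (hs : s ≠ 1) (h : 0 < (shifted y s).im) :
    cone y s = pt (UpperHalfPlane.ofComplex (shifted y s)) := by
  rw [cone, if_neg (not_or.2 ⟨hy, hs⟩), if_pos h]

/-- The last branch of `cone` is reached only at the start of the vertical line over a rational
cusp. -/
theorem eq_coe_of_shifted_im {y : ExtendedHalfPlane} {s : unitInterval}
    (hy : y ≠ cusp OnePoint.infty) (hs : s ≠ 1) (h : ¬ 0 < (shifted y s).im) :
    (∃ r : ℚ, y = cusp (r : OnePoint ℚ)) ∧ s = 0 := by
  rw [shifted_im] at h
  have h1 := ratio_nonneg s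
  have h2 := position_im_nonneg y
  have h3 : (s : ℝ) < 1 := lt_of_le_of_ne s.2.2 fun h => hs (Subtype.ext h)
  refine ⟨?_, ?_⟩
  · cases y with
    | pt z => exact absurd z.im_pos (by simp only [position_pt] at h; intro h4; exact h (by
        have : (z : ℂ).im = z.im := rfl
        linarith))
    | cusp c =>
      cases c with
      | infty => exact absurd rfl hy
      | coe r => exact ⟨r, rfl⟩
  · have h4 : (s : ℝ) / (1 - s) = 0 := by linarith
    rcases div_eq_zero_iff.1 h4 with h5 | h5
    · exact Subtype.ext h5
    · linarith

theorem cone_zero (y : ExtendedHalfPlane) : cone y 0 = y := by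
  by_cases hy : y = cusp OnePoint.infty
  · rw [hy, cone_infty]
  by_cases h : 0 < (shifted y 0).im
  · rw [cone_of_im_pos hy zero_ne_one h]
    have : shifted y 0 = position y := by simp [shifted]
    rw [this] at h ⊢
    cases y with
    | pt z => exact congrArg pt (UpperHalfPlane.ofComplex_apply z)
    | cusp c =>
      cases c with
      | infty => exact absurd rfl hy
      | coe r => simp at h
  · rw [cone, if_neg (not_or.2 ⟨hy, zero_ne_one⟩), if_neg h]

theorem isClosed_infty : IsClosed {cusp OnePoint.infty} := by
  refine isOpen_compl_iff.1 (isOpen_iff.2 ⟨?_, fun c _ => ⟨0, fun z _ => ?_⟩⟩)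
  · convert isOpen_univ (X := ℍ) using 1
    ext z
    simp
  · simp

theorem eventually_lt_ratio (T : ℝ) :
    ∀ᶠ s : unitInterval in 𝓝 1, s = 1 ∨ T < (s : ℝ) / (1 - s) := by
  have h := (tendsto_div_self_one_sub.eventually_gt_atTop T)
  rw [eventually_nhdsWithin_iff] at h
  have hc : Tendsto (fun s : unitInterval => (s : ℝ)) (𝓝 1) (𝓝 1) :=
    continuous_subtype_val.tendsto' _ _ rfl
  filter_upwards [hc.eventually h] with s hs
  rcases eq_or_lt_of_le s.2.2 with h1 | h1
  · exact Or.inl (Subtype.ext h1)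
  · exact Or.inr (hs h1)

theorem continuousAt_ratio {s : unitInterval} (hs : s ≠ 1) :
    ContinuousAt (fun s : unitInterval => (s : ℝ) / (1 - s)) s := by
  refine ContinuousAt.div (by fun_prop) (by fun_prop) fun h => hs (Subtype.ext ?_)
  simp only [Set.Icc.coe_one]
  linarith

theorem cone_mem_horoball_infty {y : ExtendedHalfPlane} {s : unitInterval} {T : ℝ} (hT : 0 < T)
    (h : y = cusp OnePoint.infty ∨ s = 1 ∨ T < (shifted y s).im) :
    cone y s ∈ horoball OnePoint.infty T := by
  by_cases hy : y = cusp OnePoint.infty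
  · rw [hy, cone_infty]
    exact Set.mem_insert _ _
  by_cases hs : s = 1
  · rw [hs, cone_one]
    exact Set.mem_insert _ _
  have h3 : T < (shifted y s).im := by tauto
  rw [cone_of_im_pos hy hs (hT.trans h3)]
  refine Or.inr ⟨_, ?_, rfl⟩
  rw [UpperHalfPlane.ofComplex_apply_of_im_pos (hT.trans h3)]
  exact h3

/-- A point of the horoball of height `4T` stays in that of height `T` after a small vertical shift.
In `T(x² + (y + d)²)` the part `T(x² + y²)` is below `y / 4`, the part `2Tyd` is at most `d / 2`
because `4Ty < 1`, and `Td²` is at most `d / 4`. -/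
theorem lt_height_shift {T x y d : ℝ} (hT : 0 < T) (hy : 0 < y) (hd : 0 ≤ d)
    (h : 4 * T < y / (x ^ 2 + y ^ 2)) (hdT : 4 * T * d < 1) :
    T < (y + d) / (x ^ 2 + (y + d) ^ 2) := by
  rw [lt_div_iff₀ (by positivity)] at h ⊢
  have h1 : 4 * T * y < 1 := by
    by_contra! h2
    nlinarith [mul_nonneg hT.le (sq_nonneg x)]
  nlinarith [mul_nonneg hd hd, mul_nonneg hT.le (sq_nonneg y), mul_nonneg hT.le (sq_nonneg x)]

theorem height_coe_mk (r : ℚ) {w : ℂ} (hw : 0 < w.im) :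
    height (r : OnePoint ℚ) (UpperHalfPlane.ofComplex w) =
      w.im / ((w.re - r) ^ 2 + w.im ^ 2) := by
  rw [UpperHalfPlane.ofComplex_apply_of_im_pos hw, height_coe]
  change w.im / Complex.normSq (w - ((r : ℝ) : ℂ)) = _
  rw [Complex.normSq_apply]
  simp [sq]

/-- Where the value lies in `ℍ`, the explicit formula is continuous. Near `y = ∞` or `s = 1` the
imaginary part becomes large. The delicate point is `s = 0` at a rational cusp, where
`lt_height_shift` keeps the values inside a horoball. -/
theorem continuous_cone : Continuous fun p : ExtendedHalfPlane × unitInterval => cone p.1 p.2 := by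
  rw [continuous_iff_continuousAt]
  rintro ⟨y₀, s₀⟩
  by_cases hy : y₀ = cusp OnePoint.infty
  · subst hy
    rw [ContinuousAt, cone_infty]
    refine tendsto_cusp_of_horoball fun T hT => ?_
    filter_upwards [continuous_fst.continuousAt.eventually
      (horoball_mem_nhds OnePoint.infty T)] with p hp
    refine cone_mem_horoball_infty hT ?_
    rcases hp with hp | ⟨z, hz, hp⟩
    · exact Or.inl hp
    · refine Or.inr (Or.inr ?_)
      rw [← hp, shifted_im]
      exact lt_add_of_lt_of_nonneg hz (ratio_nonneg _)
  by_cases hs : s₀ = 1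
  · subst hs
    rw [ContinuousAt, cone_one]
    refine tendsto_cusp_of_horoball fun T hT => ?_
    filter_upwards [continuous_snd.continuousAt.eventually (eventually_lt_ratio T)] with p hp
    refine cone_mem_horoball_infty hT (Or.inr (hp.imp_right fun hp => ?_))
    rw [shifted_im]
    exact lt_add_of_nonneg_of_lt (position_im_nonneg _) hp
  have hey : ∀ᶠ p : ExtendedHalfPlane × unitInterval in 𝓝 (y₀, s₀),
      p.1 ≠ cusp OnePoint.infty :=
    (continuous_fst.tendsto (y₀, s₀)).eventually (isClosed_infty.isOpen_compl.mem_nhds hy)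
  have hes : ∀ᶠ p : ExtendedHalfPlane × unitInterval in 𝓝 (y₀, s₀), p.2 ≠ 1 :=
    (continuous_snd.tendsto (y₀, s₀)).eventually (isOpen_ne.mem_nhds hs)
  by_cases him : 0 < (shifted y₀ s₀).im
  · have hsh : ContinuousAt (fun p : ExtendedHalfPlane × unitInterval => shifted p.1 p.2)
        (y₀, s₀) := by
      refine ContinuousAt.add
        (ContinuousAt.comp (f := Prod.fst) (continuousAt_position hy) continuousAt_fst)
        (ContinuousAt.mul (Complex.continuous_ofReal.continuousAt.comp ?_) continuousAt_const)
      exact ContinuousAt.comp (f := Prod.snd) (continuousAt_ratio hs) continuousAt_snd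
    have hei : ∀ᶠ p : ExtendedHalfPlane × unitInterval in 𝓝 (y₀, s₀), 0 < (shifted p.1 p.2).im :=
      (Complex.continuous_im.continuousAt.comp hsh).eventually (lt_mem_nhds him)
    have hof : ContinuousAt (fun w => pt (UpperHalfPlane.ofComplex w)) (shifted y₀ s₀) := by
      refine continuous_pt.continuousAt.comp (UpperHalfPlane.ofComplex.continuousAt ?_)
      simpa [UpperHalfPlane.ofComplex] using him
    refine (ContinuousAt.comp (f := fun p : ExtendedHalfPlane × unitInterval => shifted p.1 p.2)
      hof hsh).congr ?_
    filter_upwards [hey, hes, hei] with p h1 h2 h3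
    exact (cone_of_im_pos h1 h2 h3).symm
  · obtain ⟨⟨r, rfl⟩, rfl⟩ := eq_coe_of_shifted_im hy hs him
    rw [ContinuousAt, cone_zero]
    refine tendsto_cusp_of_horoball fun T hT => ?_
    have hd : ∀ᶠ s : unitInterval in 𝓝 0, 4 * T * ((s : ℝ) / (1 - s)) < 1 := by
      refine ((continuousAt_ratio zero_ne_one).const_mul (4 * T)).eventually (gt_mem_nhds ?_)
      simp
    filter_upwards [hey, hes, continuous_fst.continuousAt.eventually
      (horoball_mem_nhds (r : OnePoint ℚ) (4 * T)),
      continuous_snd.continuousAt.eventually hd] with p h1 h2 h3 h4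
    have h5 := ratio_nonneg p.2
    by_cases h0 : 0 < (shifted p.1 p.2).im
    · rw [cone_of_im_pos h1 h2 h0]
      refine Or.inr ⟨_, ?_, rfl⟩
      change T < height _ _
      rw [height_coe_mk r h0]
      rw [shifted_im] at h0
      rw [shifted_re, shifted_im]
      rcases h3 with h3 | ⟨z, hz, h3⟩
      · rw [h3] at h0 ⊢
        simp only [position_coe, Complex.ofReal_re, Complex.ofReal_im, zero_add, sub_self] at h0 ⊢
        rw [lt_div_iff₀ (by positivity)]
        nlinarith
      · rw [← h3] at h0 ⊢
        refine lt_height_shift hT z.im_pos h5 ?_ h4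
        rw [Set.mem_ofPred_eq, height_coe, Complex.normSq_apply] at hz
        simpa [sq] using hz
    · obtain ⟨⟨r', h6⟩, h7⟩ := eq_coe_of_shifted_im h1 h2 h0
      rw [h7, cone_zero]
      rcases h3 with h3 | ⟨z, hz, h3⟩
      · exact Or.inl h3
      · rw [h6] at h3
        cases h3

end ExtendedHalfPlane

/-! ### Identifications made by `Γ₁(M)` near a point. -/

namespace ExtendedHalfPlane

theorem det_eq (γ : SL(2, ℤ)) : γ 0 0 * γ 1 1 - γ 0 1 * γ 1 0 = 1 := by
  have := γ.det_coe
  rwa [Matrix.det_fin_two] at this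

theorem coe_smul_eq (γ : SL(2, ℤ)) (z : ℍ) : ((γ • z : ℍ) : ℂ) =
    (((γ 0 0 : ℤ) : ℂ) * z + (γ 0 1 : ℤ)) / (((γ 1 0 : ℤ) : ℂ) * z + (γ 1 1 : ℤ)) := by
  simpa using UpperHalfPlane.coe_specialLinearGroup_apply γ z

theorem linear_ne_zero (γ : SL(2, ℤ)) (z : ℍ) :
    ((γ 1 0 : ℤ) : ℂ) * z + (γ 1 1 : ℤ) ≠ 0 := by
  simpa [UpperHalfPlane.denom] using UpperHalfPlane.denom_ne_zero γ z

theorem im_smul_eq (γ : SL(2, ℤ)) (z : ℍ) :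
    (γ • z).im = z.im / Complex.normSq (((γ 1 0 : ℤ) : ℂ) * z + (γ 1 1 : ℤ)) := by
  simpa [UpperHalfPlane.denom] using UpperHalfPlane.im_smul_eq_div_normSq γ z

theorem smul_infty_eq_iff (γ : SL(2, ℤ)) :
    γ • cusp OnePoint.infty = cusp OnePoint.infty ↔ γ 1 0 = 0 := by
  rw [smul_cusp]
  simp [OnePoint.smul_infty_eq_self_iff]

/-- An upper triangular matrix acts by an integral translation. -/
theorem exists_translation {ε : SL(2, ℤ)} (h : ε 1 0 = 0) : ∃ n : ℤ,
    (∀ z : ℍ, ((ε • z : ℍ) : ℂ) = z + n) ∧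
    ∀ r : ℚ, ε • cusp (r : OnePoint ℚ) = cusp ((r + n : ℚ) : OnePoint ℚ) := by
  have hd := det_eq ε
  rw [h, mul_zero, sub_zero] at hd
  have hz (z : ℍ) := coe_smul_eq ε z
  have hr (r : ℚ) : ε • cusp (r : OnePoint ℚ) =
      cusp (((ε 0 0 * r + ε 0 1) / ε 1 1 : ℚ) : OnePoint ℚ) := by
    have h11 : ε 1 1 ≠ 0 := fun h => by simp [h] at hd
    rw [smul_cusp, OnePoint.smul_some_eq_ite]
    simp [h, h11]
  rcases Int.mul_eq_one_iff_eq_one_or_neg_one.1 hd with ⟨h0, h1⟩ | ⟨h0, h1⟩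
  · refine ⟨ε 0 1, fun z => ?_, fun r => ?_⟩
    · rw [hz, h, h0, h1]; simp
    · rw [hr, h0, h1]; simp
  · refine ⟨-ε 0 1, fun z => ?_, fun r => ?_⟩
    · rw [hz, h, h0, h1]; push_cast; ring
    · rw [hr, h0, h1]; push_cast; congr 2; ring

/-- Horizontal translations commute with moving vertically. -/
theorem cone_smul {ε : SL(2, ℤ)} (h : ε 1 0 = 0) (y : ExtendedHalfPlane) (s : unitInterval) :
    cone (ε • y) s = ε • cone y s := by
  have hinf := (smul_infty_eq_iff ε).2 h
  by_cases hy : y = cusp OnePoint.infty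
  · rw [hy, hinf, cone_infty, hinf]
  by_cases hs : s = 1
  · rw [hs, cone_one, cone_one, hinf]
  have hy' : ε • y ≠ cusp OnePoint.infty := by
    rwa [← hinf, Ne, smul_left_cancel_iff]
  obtain ⟨n, hn, hn'⟩ := exists_translation h
  have hpos : position (ε • y) = position y + n := by
    cases y with
    | pt z => exact hn z
    | cusp c =>
      cases c with
      | infty => exact absurd rfl hy
      | coe r =>
        rw [hn']
        simp
  have hsh : shifted (ε • y) s = shifted y s + n := by
    rw [shifted, hpos, shifted]
    ring
  have him : (shifted (ε • y) s).im = (shifted y s).im := by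
    rw [hsh]
    simp
  by_cases h0 : 0 < (shifted y s).im
  · rw [cone_of_im_pos hy hs h0, cone_of_im_pos hy' hs (him ▸ h0), smul_pt]
    refine congrArg pt (UpperHalfPlane.ext ?_)
    rw [UpperHalfPlane.ofComplex_apply_of_im_pos h0,
      UpperHalfPlane.ofComplex_apply_of_im_pos (him ▸ h0), hn]
    exact hsh
  · obtain ⟨-, rfl⟩ := eq_coe_of_shifted_im hy hs h0
    rw [cone_zero, cone_zero]

/-- If the lower row is `(c, d)` with `c ≠ 0` and `Im z > 1`, then `Im (εz) = Im z / |cz + d|² ≤ 1 /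
(c² Im z) < 1`. -/
theorem lower_left_eq_zero_of_mem_horoball {ε : SL(2, ℤ)} {w : ExtendedHalfPlane}
    (hw : w ∈ horoball OnePoint.infty 1) (hw' : ε • w ∈ horoball OnePoint.infty 1) :
    ε 1 0 = 0 := by
  rcases hw with rfl | ⟨z, hz, rfl⟩
  · rw [← smul_infty_eq_iff]
    rcases hw' with h | ⟨z, -, h⟩
    · exact h
    · cases h
  · have h2 : 1 < (ε • z).im := by
      rcases hw' with h | ⟨z', hz', h⟩
      · cases h
      · rw [smul_pt] at h
        rw [← pt_injective h]
        exact hz'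
    replace hz : 1 < z.im := hz
    by_contra h
    have h3 : (1 : ℝ) ≤ ((ε 1 0 : ℤ) : ℝ) ^ 2 := by
      have : (1 : ℤ) ≤ (ε 1 0) ^ 2 := by
        have := sq_pos_of_ne_zero h
        omega
      exact_mod_cast this
    rw [im_smul_eq, lt_div_iff₀ (Complex.normSq_pos.2 (linear_ne_zero ε z)),
      Complex.normSq_apply] at h2
    simp only [Complex.add_re, Complex.add_im, Complex.mul_re, Complex.mul_im, Complex.intCast_re,
      Complex.intCast_im, UpperHalfPlane.coe_re, UpperHalfPlane.coe_im] at h2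
    nlinarith [mul_self_nonneg (((ε 1 0 : ℤ) : ℝ) * z.re + (ε 1 1 : ℤ)), mul_pos z.im_pos z.im_pos]

/-- Pairs of points of `ℍ` that are too close to be related by an element of trace `±2`
other than `±1`, or by a hyperbolic element. -/
def closePairs : Set (ℍ × ℍ) :=
  {p | Complex.normSq ((p.2 : ℂ) - p.1) < p.1.im * p.2.im ∧
    Complex.normSq ((p.2 : ℂ) - p.1) < p.1.im ^ 3 * p.2.im ∧
    Complex.normSq ((p.2 : ℂ) - p.1) * p.1.im < p.2.im}

theorem isOpen_closePairs : IsOpen closePairs := by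
  have h1 : Continuous fun p : ℍ × ℍ => Complex.normSq ((p.2 : ℂ) - p.1) :=
    Complex.continuous_normSq.comp (by fun_prop)
  have h2 : Continuous fun p : ℍ × ℍ => p.1.im := UpperHalfPlane.continuous_im.comp continuous_fst
  have h3 : Continuous fun p : ℍ × ℍ => p.2.im := UpperHalfPlane.continuous_im.comp continuous_snd
  exact (isOpen_lt h1 (h2.mul h3)).inter ((isOpen_lt h1 ((h2.pow 3).mul h3)).inter
    (isOpen_lt (h1.mul h2) h3))

theorem diag_mem_closePairs (z : ℍ) : (z, z) ∈ closePairs := by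
  have := z.im_pos
  refine ⟨?_, ?_, ?_⟩ <;> simp only [sub_self, map_zero, zero_mul] <;> positivity

/-- Write `z = x + iy` and `N = |cz² + (d - a)z - b|²`, which measures how far `z` is from being
fixed. The bound `N < y²` forces trace `±2`, the bound `N < y⁴` then forces `c = 0`, and `N < 1`
finally forces the integer `b` to vanish. -/
theorem diagonal_of_close {M : ℕ} (hM : 3 < M) {a b c d : ℤ} (hdet : a * d - b * c = 1)
    (htr : (M : ℤ) ∣ a + d - 2) {x y : ℝ} (hy : 0 < y)
    (h1 : (c * (x ^ 2 - y ^ 2) + (d - a) * x - b) ^ 2 + ((2 * c * x + (d - a)) * y) ^ 2 < y * y)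
    (h2 : (c * (x ^ 2 - y ^ 2) + (d - a) * x - b) ^ 2 + ((2 * c * x + (d - a)) * y) ^ 2 <
      y ^ 3 * y)
    (h3 : ((c * (x ^ 2 - y ^ 2) + (d - a) * x - b) ^ 2 + ((2 * c * x + (d - a)) * y) ^ 2) * y <
      y) : b = 0 ∧ c = 0 ∧ a = d := by
  have hdetR : (a : ℝ) * d - b * c = 1 := by exact_mod_cast hdet
  have htr5 : ((a + d : ℤ) : ℝ) ^ 2 < 5 := by
    -- The real part of `cz² + (d - a)z - b` enters through `2cy² + Re = c|z|² + (d - a)x - b`.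
    -- Dropping its square leaves `y²(tr² - 4) ≤ N < y²`.
    have h : y ^ 2 * (((a + d : ℤ) : ℝ) ^ 2 - 4) =
        (c * (x ^ 2 - y ^ 2) + (d - a) * x - b) ^ 2 + ((2 * c * x + (d - a)) * y) ^ 2
        - (2 * c * y ^ 2 + (c * (x ^ 2 - y ^ 2) + (d - a) * x - b)) ^ 2 := by
      push_cast
      linear_combination (4 * y ^ 2) * hdetR
    have h' : y ^ 2 * (((a + d : ℤ) : ℝ) ^ 2 - 4) < y ^ 2 * 1 := by
      rw [h]
      nlinarith [sq_nonneg (2 * c * y ^ 2 + (c * (x ^ 2 - y ^ 2) + (d - a) * x - b))]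
    linarith [lt_of_mul_lt_mul_left h' (by positivity)]
  have htr5' : (a + d) ^ 2 < 5 := by exact_mod_cast htr5
  have htr4 : (a + d) ^ 2 = 4 := by
    have hle : a + d ≤ 2 := by nlinarith
    have hge : -2 ≤ a + d := by nlinarith
    obtain ⟨k, hk⟩ := htr
    have hM' : (4 : ℤ) ≤ M := by exact_mod_cast hM
    rcases lt_trichotomy k 0 with h | h | h
    · have h5 : a + d = -2 := by nlinarith
      rw [h5]
      norm_num
    · have h5 : a + d = 2 := by
        rw [h] at hk
        linarith
      rw [h5]
      norm_num
    · nlinarith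
  have hdisc : (d - a) ^ 2 + 4 * b * c = 0 := by linear_combination htr4 - 4 * hdet
  have hdiscR : ((d : ℝ) - a) ^ 2 + 4 * b * c = 0 := by exact_mod_cast hdisc
  have hc : c = 0 := by
    by_contra hc
    have hc1 : (1 : ℝ) ≤ (c : ℝ) ^ 2 := by
      have : (1 : ℤ) ≤ c ^ 2 := by
        have := sq_pos_of_ne_zero hc
        omega
      exact_mod_cast this
    -- With zero discriminant, `c` times the quadratic polynomial is the square of `cz + (d - a) /
    -- 2`. Hence `c²N ≥ c⁴y⁴ ≥ c²y⁴`, against `N < y⁴`.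
    have h : (c : ℝ) ^ 2 * ((c * (x ^ 2 - y ^ 2) + (d - a) * x - b) ^ 2 +
        ((2 * c * x + (d - a)) * y) ^ 2) =
        ((2 * c * x + (d - a)) ^ 2 / 4 + c ^ 2 * y ^ 2) ^ 2 := by
      linear_combination ((1 / 16) * (((d : ℝ) - a) ^ 2 + 4 * b * c)
        + (1 / 2) * ((c : ℝ) ^ 2 * y ^ 2 - (2 * c * x + (d - a)) ^ 2 / 4)) * hdiscR
    have h5 : (c : ℝ) ^ 2 * (c ^ 2 * y ^ 4) ≤ c ^ 2 * (y ^ 3 * y) := by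
      have := mul_le_mul_of_nonneg_left h2.le (sq_nonneg (c : ℝ))
      rw [h] at this
      refine le_trans ?_ this
      nlinarith [mul_nonneg (sq_nonneg (2 * (c : ℝ) * x + (d - a)))
        (mul_nonneg (sq_nonneg (c : ℝ)) (sq_nonneg y)), sq_nonneg ((2 * (c : ℝ) * x + (d - a)) ^ 2)]
    have h6 : (c : ℝ) ^ 2 * ((c * (x ^ 2 - y ^ 2) + (d - a) * x - b) ^ 2 +
        ((2 * c * x + (d - a)) * y) ^ 2) < c ^ 2 * (y ^ 3 * y) :=
      mul_lt_mul_of_pos_left h2 (by positivity)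
    rw [h] at h6
    nlinarith [mul_nonneg (sq_nonneg (2 * (c : ℝ) * x + (d - a)))
        (mul_nonneg (sq_nonneg (c : ℝ)) (sq_nonneg y)), sq_nonneg ((2 * (c : ℝ) * x + (d - a)) ^ 2),
        mul_nonneg (sub_nonneg.2 hc1) (mul_nonneg (sq_nonneg (c : ℝ)) (pow_nonneg hy.le 4))]
  have had : a = d := by
    rw [hc, mul_zero, add_zero] at hdisc
    have := pow_eq_zero_iff two_ne_zero |>.1 hdisc
    omega
  refine ⟨?_, hc, had⟩
  have hb : ((b ^ 2 : ℤ) : ℝ) < 1 := by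
    rw [hc, had] at h3
    have h4 : (b : ℝ) ^ 2 * y < 1 * y := by
      rw [one_mul]
      convert h3 using 1
      push_cast
      ring
    push_cast
    exact lt_of_mul_lt_mul_right h4 hy.le
  have hb' : b ^ 2 < 1 := by exact_mod_cast hb
  by_contra h
  have := sq_pos_of_ne_zero h
  omega

theorem eq_one_or_neg_one_of_close {M : ℕ} (hM : 3 < M) {δ : SL(2, ℤ)} (hδ : δ ∈ Gamma1 M)
    {z : ℍ} (hz : (z, δ • z) ∈ closePairs) : δ = 1 ∨ δ = -1 := by
  obtain ⟨h1, h2, h3⟩ := hz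
  have hdet := det_eq δ
  have hy := z.im_pos
  have hdenpos := Complex.normSq_pos.2 (linear_ne_zero δ z)
  -- Multiplication by `|cz + d|²` clears denominators: it turns `|δz - z|²` into `|cz² + (d - a)z -
  -- b|²` and `Im (δz)` into `Im z`.
  have hN : Complex.normSq (((δ • z : ℍ) : ℂ) - z) *
      Complex.normSq (((δ 1 0 : ℤ) : ℂ) * z + (δ 1 1 : ℤ)) =
      (δ 1 0 * (z.re ^ 2 - z.im ^ 2) + (δ 1 1 - δ 0 0) * z.re - δ 0 1) ^ 2 +
        ((2 * δ 1 0 * z.re + (δ 1 1 - δ 0 0)) * z.im) ^ 2 := by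
    rw [← map_mul, coe_smul_eq, sub_mul, div_mul_cancel₀ _ (linear_ne_zero δ z),
      Complex.normSq_apply]
    simp only [Complex.add_re, Complex.add_im, Complex.mul_re, Complex.mul_im, Complex.intCast_re,
      Complex.intCast_im, UpperHalfPlane.coe_re, UpperHalfPlane.coe_im, Complex.sub_re,
      Complex.sub_im]
    ring
  have him := im_smul_eq δ z
  rw [eq_div_iff hdenpos.ne'] at him
  simp only at h1 h2 h3
  have k1 := mul_lt_mul_of_pos_right h1 hdenpos
  have k2 := mul_lt_mul_of_pos_right h2 hdenpos
  have k3 := mul_lt_mul_of_pos_right h3 hdenpos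
  rw [mul_assoc _ (δ • z).im, him, hN] at k1 k2
  rw [mul_right_comm, him, hN] at k3
  clear h1 h2 h3 him hN hdenpos
  obtain ⟨hm0, hm1, -⟩ := (Gamma1_mem M δ).1 hδ
  have htr : (M : ℤ) ∣ δ 0 0 + δ 1 1 - 2 := by
    rw [← ZMod.intCast_zmod_eq_zero_iff_dvd]
    push_cast
    rw [hm0, hm1]
    norm_num
  obtain ⟨hb, hc, had⟩ := diagonal_of_close hM hdet htr hy k1 k2 k3
  rw [hb, hc, had, mul_zero, sub_zero] at hdet
  rcases Int.mul_eq_one_iff_eq_one_or_neg_one.1 hdet with ⟨h, -⟩ | ⟨h, -⟩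
  · left
    ext i j
    fin_cases i <;> fin_cases j <;> simp [hb, hc, had, h]
  · right
    ext i j
    fin_cases i <;> fin_cases j <;> simp [hb, hc, had, h]

end ExtendedHalfPlane

namespace ModularCurve

open ExtendedHalfPlane SingularPair

/-- Open sets of `ℍ ∪ ℙ¹(ℚ)` on which the elements of `Γ₁(M)` identify points only through
elements that fix a cusp and respect the contraction to the cusp `α ∞`. -/
structure IsGood (M : ℕ) (U : Set ExtendedHalfPlane) (α : SL(2, ℤ)) : Prop where
  isOpen : IsOpen U
  cusp_eq : ∀ c c', cusp c ∈ U → cusp c' ∈ U → c = c'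
  exists_fixed : ∀ δ ∈ Gamma1 M, ∀ w ∈ U, δ • w ∈ U →
    ∃ c : OnePoint ℚ, Matrix.SpecialLinearGroup.mapGL ℚ δ • c = c
  cone_eq : ∀ δ ∈ Gamma1 M, ∀ w ∈ U, δ • w ∈ U → ∀ s,
    proj M (α • cone (α⁻¹ • δ • w) s) = proj M (α • cone (α⁻¹ • w) s)

/-- Around a point of `ℍ` a small set admits only the identifications `±1`, which act trivially. At
a cusp `c = α∞` the `α`-translate of a horoball at `∞` works: an identifying `δ` has `α⁻¹δα` upper
triangular, so `δ` fixes `c` and respects the contraction transported by `α`. -/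
theorem exists_isGood {M : ℕ} (hM : 3 < M) (y : ExtendedHalfPlane) :
    ∃ U α, y ∈ U ∧ IsGood M U α := by
  cases y with
  | pt z =>
    obtain ⟨B, hB, hBo, hzB, hBB⟩ : ∃ B : Set ℍ, B ∈ 𝓝 z ∧ IsOpen B ∧ z ∈ B ∧
        B ×ˢ B ⊆ closePairs := by
      have := isOpen_closePairs.mem_nhds (diag_mem_closePairs z)
      rw [nhds_prod_eq, mem_prod_self_iff] at this
      obtain ⟨B, hB, hBB⟩ := this
      obtain ⟨O, hO, hOo, hz⟩ := mem_nhds_iff.1 hB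
      exact ⟨O, hOo.mem_nhds hz, hOo, hz, (Set.prod_mono hO hO).trans hBB⟩
    have key (δ : SL(2, ℤ)) (hδ : δ ∈ Gamma1 M) (w : ExtendedHalfPlane) (hw : w ∈ pt '' B)
        (hw' : δ • w ∈ pt '' B) : δ = 1 ∨ δ = -1 := by
      obtain ⟨w, hw, rfl⟩ := hw
      obtain ⟨w', hw', h⟩ := hw'
      rw [smul_pt] at h
      obtain rfl := pt_injective h
      exact eq_one_or_neg_one_of_close hM hδ (hBB (Set.mk_mem_prod hw hw'))
    have triv (δ : SL(2, ℤ)) (hδ : δ = 1 ∨ δ = -1) (w : ExtendedHalfPlane) : δ • w = w := by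
      rcases hδ with rfl | rfl
      · exact one_smul _ w
      · rw [ExtendedHalfPlane.neg_smul, one_smul]
    refine ⟨pt '' B, 1, ⟨z, hzB, rfl⟩, isOpenEmbedding_pt.isOpenMap _ hBo, ?_, ?_, ?_⟩
    · rintro c c' ⟨_, _, h⟩
      cases h
    · intro δ hδ w hw hw'
      -- Here `δ = ±1` fixes every cusp, and `∞` is an arbitrary choice.
      refine ⟨OnePoint.infty, ?_⟩
      have := triv δ (key δ hδ w hw hw') (cusp OnePoint.infty)
      rw [smul_cusp] at this
      injection this
    · intro δ hδ w hw hw' s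
      rw [triv δ (key δ hδ w hw hw')]
  | cusp c =>
    obtain ⟨α, hα⟩ := OnePoint.exists_mem_SL2 ℤ c
    have hα' : α • cusp OnePoint.infty = cusp c := congrArg cusp hα
    have hcusp (c' : OnePoint ℚ) (h : α⁻¹ • cusp c' ∈ horoball OnePoint.infty 1) : c' = c := by
      have : α⁻¹ • cusp c' = cusp OnePoint.infty := by
        rcases h with h | ⟨z, -, h⟩
        · exact h
        · cases h
      rw [inv_smul_eq_iff, hα'] at this
      injection this
    have key (δ : SL(2, ℤ)) (w : ExtendedHalfPlane) (hw : α⁻¹ • w ∈ horoball OnePoint.infty 1)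
        (hw' : α⁻¹ • δ • w ∈ horoball OnePoint.infty 1) : (α⁻¹ * δ * α) 1 0 = 0 := by
      refine lower_left_eq_zero_of_mem_horoball hw ?_
      rwa [mul_smul, mul_smul, smul_inv_smul]
    refine ⟨(fun y => α⁻¹ • y) ⁻¹' horoball OnePoint.infty 1, α, ?_,
      (isOpen_horoball _ _).preimage (continuous_const_smul _), ?_, ?_, ?_⟩
    · rw [Set.mem_preimage, ← hα', inv_smul_smul]
      exact Set.mem_insert _ _
    · intro c₁ c₂ h₁ h₂
      rw [hcusp c₁ h₁, hcusp c₂ h₂]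
    · intro δ hδ w hw hw'
      have := (smul_infty_eq_iff _).2 (key δ w hw hw')
      rw [mul_smul, mul_smul, inv_smul_eq_iff, hα', smul_cusp] at this
      injection this with h
      exact ⟨c, h⟩
    · intro δ hδ w hw hw' s
      refine proj_eq_iff.2 ⟨δ, hδ, ?_⟩
      have := cone_smul (key δ w hw hw') (α⁻¹ • w) s
      rw [mul_smul, mul_smul, smul_inv_smul] at this
      rw [this]
      simp only [mul_smul, smul_inv_smul]

end ModularCurve

/-! ### Generation of the relative homology by the symbols `{0, γ0}`. -/

namespace SingularPair

variable {X : Type*} [TopologicalSpace X]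

/-- The inclusion of `H₁(X, A; ℤ)` in the chains modulo relative boundaries. -/
def relIncl (A : Set X) : RelH₁ A →ₗ[ℤ] Chain X 1 ⧸ relBoundaries A :=
  Submodule.mapQ _ _ (relCycles A).subtype le_rfl

/-- This allows identities in relative homology to be checked with classes such as `trackClass`,
which are not relative cycles. -/
theorem relIncl_injective (A : Set X) : Function.Injective (relIncl A) := by
  rw [injective_iff_map_eq_zero]
  intro c hc
  induction c using Submodule.Quotient.induction_on with
  | _ c =>
    exact (Submodule.Quotient.mk_eq_zero _).2 
      ((Submodule.Quotient.mk_eq_zero (relBoundaries A)).1 hc)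

/-- The projection from chains modulo boundaries to chains modulo relative boundaries. -/
def relProj (A : Set X) : ChainClass X →ₗ[ℤ] Chain X 1 ⧸ relBoundaries A :=
  Submodule.mapQ _ _ LinearMap.id (le_sup_right (a := chainsIn A 1))

theorem relIncl_pathClass {A : Set X} {a b : X} (p : Path a b) (ha : a ∈ A) (hb : b ∈ A) :
    relIncl A (pathClass p ha hb) = relProj A (cls (curveSimplex p.toContinuousMap)) := rfl

end SingularPair

namespace ModularCurve

open ExtendedHalfPlane SingularPair

variable (M : ℕ)

instance : ContinuousConstSMul (Gamma1 M) ExtendedHalfPlane :=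
  ⟨fun γ => continuous_const_smul (γ : SL(2, ℤ))⟩

theorem isOpenMap_proj : IsOpenMap (proj M) :=
  isOpenMap_quotient_mk'_mul (Γ := Gamma1 M) (T := ExtendedHalfPlane)

/-- The projection `ℍ ∪ ℙ¹(ℚ) → X₁(M)` as a continuous map. -/
def projMap : C(ExtendedHalfPlane, X₁ M) := ⟨proj M, continuous_proj M⟩

/-- The curve from `y` to the cusp `∞` traced by the vertical contraction. -/
def track (y : ExtendedHalfPlane) : C(unitInterval, ExtendedHalfPlane) :=
  ⟨cone y, continuous_cone.comp (Continuous.prodMk_right y)⟩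

/-- The class of the image in `X₁(M)` of the vertical curve from `y` to the cusp `∞`. -/
def trackClass (y : ExtendedHalfPlane) : ChainClass (X₁ M) :=
  cls (curveSimplex ((projMap M).comp (track y)))

/-- The action of an element of `SL₂(ℤ)` as a continuous map. -/
def smulMap (γ : SL(2, ℤ)) : C(ExtendedHalfPlane, ExtendedHalfPlane) :=
  ⟨fun y => γ • y, continuous_const_smul γ⟩

/-- The class of a curve that comes from `ℍ ∪ ℙ¹(ℚ)` depends only on its end points. -/
theorem cls_proj_curve (p : C(unitInterval, ExtendedHalfPlane)) :
    cls (curveSimplex ((projMap M).comp p)) = trackClass M (p 0) - trackClass M (p 1) := by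
  -- The contraction applied along `p` sweeps out a square with bottom `p`, constant top, and the
  -- tracks of the two end points as sides.
  let G : C(unitInterval × unitInterval, X₁ M) := (projMap M).comp
    ((⟨_, continuous_cone⟩ : C(ExtendedHalfPlane × unitInterval, ExtendedHalfPlane)).comp
      (p.prodMap (.id _)))
  have h := cls_square G
  have h1 : G.comp ((ContinuousMap.id _).prodMk (.const _ 0)) = (projMap M).comp p := by
    ext s
    exact congrArg (proj M) (cone_zero _)
  have h2 : G.comp ((ContinuousMap.id _).prodMk (.const _ 1)) =
      .const _ (proj M (cusp OnePoint.infty)) := by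
    ext s
    exact congrArg (proj M) (cone_one _)
  rw [h1, h2, cls_curveSimplex_const, add_zero] at h
  exact eq_sub_of_add_eq h

/-- The cusp `0`. -/
abbrev zeroCusp : ExtendedHalfPlane := cusp ((0 : ℚ) : OnePoint ℚ)

/-- The vertical curve from `y` to `∞` and its `δ`-translate, which runs from `δy` to `δ∞`, have the
same image in `X₁(M)`. Comparing their classes shows that the difference is the class of the track
of `δ∞`, whatever `y` is. -/
theorem trackClass_smul_sub {δ : SL(2, ℤ)} (hδ : δ ∈ Gamma1 M) (y : ExtendedHalfPlane) :
    trackClass M (δ • y) - trackClass M y =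
      trackClass M (δ • zeroCusp) - trackClass M zeroCusp := by
  have key (y : ExtendedHalfPlane) :
      trackClass M (δ • y) - trackClass M y = trackClass M (δ • cusp OnePoint.infty) := by
    have h := cls_proj_curve M ((smulMap δ).comp (track y))
    have h1 : (projMap M).comp ((smulMap δ).comp (track y)) = (projMap M).comp (track y) := by
      ext s
      exact proj_eq_iff.2 ⟨δ, hδ, rfl⟩
    have h2 : (smulMap δ).comp (track y) 0 = δ • y := congrArg (δ • ·) (cone_zero y)
    have h3 : (smulMap δ).comp (track y) 1 = δ • cusp OnePoint.infty :=
      congrArg (δ • ·) (cone_one y)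
    rw [h1, h2, h3] at h
    change trackClass M y = _ at h
    rw [h, sub_sub_cancel]
  rw [key, key]

theorem relIncl_zeroSymbol (γ : Gamma0 M) : relIncl (C₀ M) (zeroSymbol M γ) =
    relProj (C₀ M) (trackClass M zeroCusp - trackClass M ((γ : SL(2, ℤ)) • zeroCusp)) := by
  let p := geodesic ((0 : ℚ) : OnePoint ℚ)
      (Matrix.SpecialLinearGroup.mapGL ℚ (γ : SL(2, ℤ)) • ((0 : ℚ) : OnePoint ℚ))
  have h := cls_proj_curve M p.toContinuousMap
  have h0 : p.toContinuousMap 0 = zeroCusp := p.source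
  have h1 : p.toContinuousMap 1 = (γ : SL(2, ℤ)) • zeroCusp := p.target
  rw [h0, h1] at h
  rw [← h]
  exact relIncl_pathClass (p.map (continuous_proj M)) _ _

theorem relIncl_diamond_smul_zeroSymbol (γ δ : Gamma0 M) :
    relIncl (C₀ M) (diamond M γ • zeroSymbol M δ) =
      relProj (C₀ M) (trackClass M ((γ : SL(2, ℤ)) • zeroCusp) -
        trackClass M ((γ : SL(2, ℤ)) • (δ : SL(2, ℤ)) • zeroCusp)) := by
  let p := geodesic ((0 : ℚ) : OnePoint ℚ)
      (Matrix.SpecialLinearGroup.mapGL ℚ (δ : SL(2, ℤ)) • ((0 : ℚ) : OnePoint ℚ))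
  have h := cls_proj_curve M ((smulMap γ).comp p.toContinuousMap)
  have h0 : (smulMap γ).comp p.toContinuousMap 0 = (γ : SL(2, ℤ)) • zeroCusp :=
    congrArg ((γ : SL(2, ℤ)) • ·) p.source
  have h1 : (smulMap γ).comp p.toContinuousMap 1 =
      (γ : SL(2, ℤ)) • (δ : SL(2, ℤ)) • zeroCusp :=
    congrArg ((γ : SL(2, ℤ)) • ·) p.target
  rw [h0, h1] at h
  rw [← h]
  let g : C(X₁ M, X₁ M) := ⟨fun x => diamond M γ • x, continuous_const_smul _⟩
  have hg : g.comp ((projMap M).comp p.toContinuousMap) =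
      (projMap M).comp ((smulMap γ).comp p.toContinuousMap) := by
    ext s
    exact diamond_smul M γ _
  have hs : chainMap g 1 (Finsupp.single (curveSimplex ((projMap M).comp p.toContinuousMap)) 1) =
      Finsupp.single (curveSimplex (g.comp ((projMap M).comp p.toContinuousMap))) 1 :=
    Finsupp.mapDomain_single
  rw [hg] at hs
  exact congrArg (Submodule.Quotient.mk (p := relBoundaries (C₀ M))) hs

/-- A path from `0` to `γδ0` may be taken through `γ0`, and its second half is the `γ`-translate of
a path from `0` to `δ0`. -/
theorem zeroSymbol_mul (γ δ : Gamma0 M) :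
    zeroSymbol M (γ * δ) = zeroSymbol M γ + diamond M γ • zeroSymbol M δ := by
  apply relIncl_injective
  rw [map_add, relIncl_zeroSymbol, relIncl_zeroSymbol, relIncl_diamond_smul_zeroSymbol, ← map_add,
    sub_add_sub_cancel, Subgroup.coe_mul, mul_smul]

/-- Taking the representatives over `C₀` in the orbit `Γ₀(M) · 0` makes the end point terms of a
relative cycle symbols `{0, γ0}`. -/
theorem exists_representatives : ∃ r : X₁ M → ExtendedHalfPlane, (∀ x, proj M (r x) = x) ∧
    ∀ x ∈ C₀ M, ∃ γ : Gamma0 M, r x = (γ : SL(2, ℤ)) • zeroCusp := by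
  have h (x : X₁ M) : ∃ y, proj M y = x ∧
      (x ∈ C₀ M → ∃ γ : Gamma0 M, y = (γ : SL(2, ℤ)) • zeroCusp) := by
    by_cases hx : x ∈ C₀ M
    · obtain ⟨g, rfl⟩ := hx
      obtain ⟨γ, rfl⟩ := diamond_surjective M g
      exact ⟨(γ : SL(2, ℤ)) • zeroCusp, (diamond_smul M γ (proj M zeroCusp)).symm, fun _ => ⟨γ, rfl⟩⟩
    · obtain ⟨y, rfl⟩ := proj_surjective M x
      exact ⟨y, rfl, fun h => absurd h hx⟩
  choose r hr using h
  exact ⟨r, fun x => (hr x).1, fun x => (hr x).2⟩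

/-- The subgroup generated by the classes of the images of curves from `0` to `γ 0`. -/
def symbolSpan : Submodule ℤ (ChainClass (X₁ M)) :=
  Submodule.span ℤ (Set.range fun γ : Gamma0 M =>
    trackClass M zeroCusp - trackClass M ((γ : SL(2, ℤ)) • zeroCusp))

variable {M}

theorem trackClass_sub_mem {y y' : ExtendedHalfPlane} (h : proj M y = proj M y') :
    trackClass M y - trackClass M y' ∈ symbolSpan M := by
  obtain ⟨δ, hδ, rfl⟩ := proj_eq_iff.1 h
  rw [trackClass_smul_sub M hδ, ← neg_sub]
  exact Submodule.neg_mem _ (Submodule.subset_span ⟨⟨δ, Gamma1_in_Gamma0 M hδ⟩, rfl⟩)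

/-- A homotopy on a good set that respects the identifications descends along curves. -/
theorem continuous_descend {U : Set ExtendedHalfPlane} (hU : IsOpen U)
    {Ψ : ExtendedHalfPlane × unitInterval → X₁ M} (hΨ : Continuous Ψ)
    (hinv : ∀ w ∈ U, ∀ w' ∈ U, proj M w = proj M w' → ∀ t, Ψ (w, t) = Ψ (w', t))
    {p : unitInterval → X₁ M} (hp : Continuous p) {w : unitInterval → ExtendedHalfPlane}
    (hwU : ∀ s, w s ∈ U) (hw : ∀ s, proj M (w s) = p s) :
    Continuous fun q : unitInterval × unitInterval => Ψ (w q.1, q.2) := by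
  rw [continuous_iff_continuousAt]
  rintro ⟨s₀, t₀⟩
  rw [ContinuousAt, tendsto_def]
  intro W hW
  have h1 : Ψ ⁻¹' W ∈ 𝓝 (w s₀, t₀) := hΨ.continuousAt hW
  rw [nhds_prod_eq, mem_prod_iff] at h1
  obtain ⟨O, hO, J, hJ, hOJ⟩ := h1
  -- The lift `w` need not be continuous. As the projection is open, a point `p s` near `p s₀` has
  -- some lift `v` in `U` close to `w s₀`, and invariance of `Ψ` allows `w s` to be replaced by `v`.
  have h2 : proj M '' (O ∩ U) ∈ 𝓝 (p s₀) := by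
    rw [← hw]
    exact (isOpenMap_proj M).image_mem_nhds (inter_mem hO (hU.mem_nhds (hwU s₀)))
  rw [nhds_prod_eq]
  filter_upwards [prod_mem_prod (hp.continuousAt h2) hJ] with q hq
  obtain ⟨⟨v, ⟨hvO, hvU⟩, hv⟩, hqJ⟩ := hq
  rw [Set.mem_preimage, hinv _ (hwU _) v hvU ((hw _).trans hv.symm)]
  exact hOJ (Set.mk_mem_prod hvO hqJ)

/-- The class of a curve in the image of a good set. -/
theorem IsGood.exists_cls_eq {U : Set ExtendedHalfPlane} {α : SL(2, ℤ)} (hU : IsGood M U α)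
    (p : C(unitInterval, X₁ M)) (hp : ∀ s, p s ∈ proj M '' U) : ∃ y y', proj M y = p 0 ∧
      proj M y' = p 1 ∧ cls (curveSimplex p) = trackClass M y - trackClass M y' := by
  choose w hwU hw using hp
  let c (y : ExtendedHalfPlane) : C(unitInterval, ExtendedHalfPlane) :=
    (smulMap α).comp (track (α⁻¹ • y))
  -- The contraction to `α∞` descends along `p`. This gives a square with bottom `p`, constant top,
  -- and sides that do lift to `ℍ ∪ ℙ¹(ℚ)`.
  let G : C(unitInterval × unitInterval, X₁ M) :=
    ⟨fun q => proj M (α • cone (α⁻¹ • w q.1) q.2), by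
      refine continuous_descend hU.isOpen (Ψ := fun q => proj M (α • cone (α⁻¹ • q.1) q.2)) ?_ ?_
        p.continuous hwU hw
      · exact (continuous_proj M).comp ((continuous_const_smul α).comp
          (continuous_cone.comp (((continuous_const_smul α⁻¹).comp continuous_fst).prodMk
            continuous_snd)))
      · intro v hv v' hv' h t
        obtain ⟨δ, hδ, rfl⟩ := proj_eq_iff.1 h
        exact hU.cone_eq δ hδ v' hv' hv t⟩
  refine ⟨w 0, w 1, hw 0, hw 1, ?_⟩
  have h := cls_square G
  have h1 : G.comp ((ContinuousMap.id _).prodMk (.const _ 0)) = p := by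
    ext s
    change proj M (α • cone (α⁻¹ • w s) 0) = p s
    rw [cone_zero, smul_inv_smul, hw]
  have h2 : G.comp ((ContinuousMap.id _).prodMk (.const _ 1)) =
      .const _ (proj M (α • cusp OnePoint.infty)) := by
    ext s
    change proj M (α • cone (α⁻¹ • w s) 1) = _
    rw [cone_one]
    rfl
  have h3 (s : unitInterval) :
      cls (curveSimplex (G.comp (.prodMk (.const _ s) (.id _)))) =
        trackClass M (w s) - trackClass M (α • cusp OnePoint.infty) := by
    have := cls_proj_curve M (c (w s))
    have hc0 : c (w s) 0 = w s := by
      change α • cone (α⁻¹ • w s) 0 = _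
      rw [cone_zero, smul_inv_smul]
    have hc1 : c (w s) 1 = α • cusp OnePoint.infty := congrArg (α • ·) (cone_one _)
    rw [hc0, hc1] at this
    exact this
  rw [h1, h2, h3, h3, cls_curveSimplex_const, add_zero] at h
  rw [eq_sub_of_add_eq h, sub_sub_sub_cancel_right]

variable {r : X₁ M → ExtendedHalfPlane}

/-- The assertion for a subcurve from `a` to `b` is transitive and holds when `b` is near `a`, where
the curve stays in the image of a good set. Connectedness of the real line yields all pairs.
Replacing lifts by the chosen representatives costs only elements of `symbolSpan`. -/
theorem cls_sub_mem (hM : 3 < M) (hr : ∀ x, proj M (r x) = x) (σ : Simplex (X₁ M) 1) :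
    cls σ - (trackClass M (r (σ (stdSimplex.vertex 0))) -
      trackClass M (r (σ (stdSimplex.vertex 1)))) ∈ symbolSpan M := by
  let F := extendCurve σ
  let P (a b : ℝ) : Prop := cls (curveSimplex (subcurve F a b)) -
    (trackClass M (r (F a)) - trackClass M (r (F b))) ∈ symbolSpan M
  suffices h : ∀ a b, P a b by
    have := h 0 1
    simp only [P, F, curveSimplex_subcurve_extendCurve, extendCurve_zero, extendCurve_one] at this
    exact this
  have htrans (a b c : ℝ) (hab : P a b) (hbc : P b c) : P a c := by
    have := Submodule.add_mem _ hab hbc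
    simp only [P]
    rw [← cls_subcurve_add F a b c]
    convert this using 1
    abel
  have hlocal (t : ℝ) : ∀ᶠ t' in 𝓝 t, P t t' ∧ P t' t := by
    obtain ⟨y, hy⟩ := proj_surjective M (F t)
    obtain ⟨U, α, hyU, hU⟩ := exists_isGood hM y
    have hV : F ⁻¹' (proj M '' U) ∈ 𝓝 t :=
      F.continuous.continuousAt ((isOpenMap_proj M _ hU.isOpen).mem_nhds ⟨y, hyU, hy⟩)
    obtain ⟨ε, hε, hball⟩ := Metric.mem_nhds_iff.1 hV
    have key (a b : ℝ) (ha : a ∈ Metric.ball t ε) (hb : b ∈ Metric.ball t ε) : P a b := by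
      obtain ⟨w, w', hw, hw', h⟩ := hU.exists_cls_eq (subcurve F a b) fun s => hball (by
        have := (convex_ball t ε).add_smul_sub_mem ha hb s.2
        simpa using this)
      have h0 : subcurve F a b 0 = F a := by simp [subcurve]
      have h1 : subcurve F a b 1 = F b := by simp [subcurve]
      rw [h0] at hw
      rw [h1] at hw'
      simp only [P]
      rw [h]
      convert Submodule.sub_mem _ (trackClass_sub_mem (hw.trans (hr (F a)).symm))
        (trackClass_sub_mem (hw'.trans (hr (F b)).symm)) using 1
      abel
    filter_upwards [Metric.ball_mem_nhds t hε] with t' ht'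
    exact ⟨key _ _ (Metric.mem_ball_self hε) ht', key _ _ ht' (Metric.mem_ball_self hε)⟩
  exact PreconnectedSpace.induction₂' P hlocal ⟨htrans⟩

/-- The symbols `{0, γ 0}` generate `H₁(X₁(M), C₀, ℤ)`. -/
theorem span_zeroSymbol (hM : 3 < M) : Submodule.span ℤ (Set.range (zeroSymbol M)) = ⊤ := by
  obtain ⟨r, hr, hrC⟩ := exists_representatives M
  -- `Λ` sends a point to the class of a curve from `0` to its representative. A chain `c` then
  -- agrees with `Λ (∂c)` modulo symbols, and `Λ` of a chain in `C₀` is itself a combination of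
  -- symbols.
  let Λ : Chain (X₁ M) 0 →ₗ[ℤ] ChainClass (X₁ M) := Finsupp.linearCombination ℤ
    fun σ : Simplex (X₁ M) 0 => trackClass M zeroCusp - trackClass M (r (σ (stdSimplex.vertex 0)))
  have hΛ (σ : Simplex (X₁ M) 0) : Λ (Finsupp.single σ 1) =
      trackClass M zeroCusp - trackClass M (r (σ (stdSimplex.vertex 0))) := by
    simp [Λ]
  have hchain (c : Chain (X₁ M) 1) :
      Submodule.Quotient.mk c - Λ (boundary (X₁ M) 0 c) ∈ symbolSpan M := by
    induction c using Finsupp.induction_linear with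
    | zero => simp
    | add a b ha hb =>
      rw [map_add, map_add, Submodule.Quotient.mk_add]
      convert Submodule.add_mem _ ha hb using 1
      abel
    | single σ k =>
      have hk : (Finsupp.single σ k : Chain (X₁ M) 1) = k • Finsupp.single σ 1 := by simp
      have hf (i : Fin 2) : face σ i (stdSimplex.vertex 0) = σ (stdSimplex.vertex (i.succAbove 0)) :=
        congrArg σ (stdSimplex.map_vertex _ _)
      rw [hk, map_smul, map_smul, Submodule.Quotient.mk_smul, ← smul_sub]
      refine Submodule.smul_mem _ k ?_
      rw [boundary_single, map_sub, hΛ, hΛ, hf, hf, sub_sub_sub_cancel_left]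
      exact cls_sub_mem hM hr σ
  have hC (c : Chain (X₁ M) 0) (hc : c ∈ chainsIn (C₀ M) 0) : Λ c ∈ symbolSpan M := by
    refine Submodule.sum_mem _ fun σ hσ => Submodule.smul_mem _ _ ?_
    obtain ⟨γ, hγ⟩ := hrC (σ (stdSimplex.vertex 0)) (hc hσ ⟨_, rfl⟩)
    change trackClass M zeroCusp - trackClass M (r (σ (stdSimplex.vertex 0))) ∈ symbolSpan M
    rw [hγ]
    exact Submodule.subset_span ⟨γ, rfl⟩
  have hmap : (symbolSpan M).map (relProj (C₀ M)) ≤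
      (Submodule.span ℤ (Set.range (zeroSymbol M))).map (relIncl (C₀ M)) := by
    rw [symbolSpan, Submodule.map_span, Submodule.map_span]
    refine Submodule.span_mono ?_
    rintro _ ⟨_, ⟨γ, rfl⟩, rfl⟩
    exact ⟨_, ⟨γ, rfl⟩, relIncl_zeroSymbol M γ⟩
  rw [eq_top_iff]
  rintro c -
  induction c using Submodule.Quotient.induction_on with
  | _ c =>
    have h1 : Submodule.Quotient.mk c.1 ∈ symbolSpan M := by
      have := Submodule.add_mem _ (hchain c.1) (hC _ c.2)
      rwa [sub_add_cancel] at this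
    obtain ⟨d, hd, hdc⟩ := hmap ⟨_, h1, rfl⟩
    have : d = Submodule.Quotient.mk c := relIncl_injective _ hdc
    rwa [← this]

end ModularCurve

/-! ### From the cocycle to a homomorphism on homology. -/

namespace ModularCurve

open ExtendedHalfPlane SingularPair

variable {M : ℕ} {T : Type*} [AddCommGroup T]

/-- A function on `ℍ ∪ ℙ¹(ℚ)` that is translated by `Γ₁(M)` through constants `κ δ` which vanish if
`δ` fixes a cusp defines a homomorphism on `H₁(X₁(M), C₀, ℤ)`. -/
theorem exists_hom_of_translated (hM : 3 < M) (κ : Gamma1 M → T) (h : ExtendedHalfPlane → T)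
    (hκ : ∀ δ : Gamma1 M,
      (∃ c : OnePoint ℚ, Matrix.SpecialLinearGroup.mapGL ℚ (δ : SL(2, ℤ)) • c = c) → κ δ = 0)
    (hh : ∀ (δ : Gamma1 M) y, h ((δ : SL(2, ℤ)) • y) = κ δ + h y) :
    ∃ v : H₁ M →ₗ[ℤ] T, ∀ γ : Gamma0 M,
      v (zeroSymbol M γ) = h ((γ : SL(2, ℤ)) • zeroCusp) - h zeroCusp := by
  classical
  choose U α hyU hU using exists_isGood (M := M) hM
  obtain ⟨r, hr, -⟩ := exists_representatives M
  -- On the image of `U i` the chosen lift is irrelevant: two lifts in `U i` differ by an element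
  -- fixing a cusp, where `κ` vanishes. The value 0 elsewhere plays no role.
  let H (i : ExtendedHalfPlane) (x : X₁ M) : T :=
    if hx : x ∈ proj M '' U i then h hx.choose else 0
  have hH (i w : ExtendedHalfPlane) (hw : w ∈ U i) : H i (proj M w) = h w := by
    have hx : proj M w ∈ proj M '' U i := ⟨w, hw, rfl⟩
    obtain ⟨h1, h2⟩ := hx.choose_spec
    simp only [H, dif_pos hx]
    obtain ⟨δ, hδ, h3⟩ := proj_eq_iff.1 h2
    rw [← h3] at h1 ⊢
    rw [hh ⟨δ, hδ⟩, hκ ⟨δ, hδ⟩ ((hU i).exists_fixed δ hδ w hw h1), zero_add]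
  let P : LocalPrimitives (X₁ M) ExtendedHalfPlane T :=
    { V := fun i => proj M '' U i
      isOpen := fun i => isOpenMap_proj M _ (hU i).isOpen
      index := r
      mem_index := fun x => ⟨r x, hyU _, hr x⟩
      h := H
      locConst := by
        rintro i j _ ⟨w, hw, rfl⟩ ⟨w', hw', h'⟩
        obtain ⟨δ, hδ, rfl⟩ := proj_eq_iff.1 h'
        -- One `δ` carrying a point of `U i` into `U j` does so for all nearby points, and there the
        -- two local functions differ by the constant `-κ δ`.
        have key (a : ExtendedHalfPlane) (ha : a ∈ U i) (hb : δ • a ∈ U j) :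
            H i (proj M a) - H j (proj M a) = -κ ⟨δ, hδ⟩ := by
          have : proj M a = proj M (δ • a) := (proj_eq_iff.2 ⟨δ, hδ, rfl⟩).symm
          rw [hH i a ha, this, hH j _ hb, hh ⟨δ, hδ⟩]
          abel
        have hO : IsOpen (U i ∩ (fun a => δ • a) ⁻¹' U j) :=
          (hU i).isOpen.inter ((hU j).isOpen.preimage (continuous_const_smul δ))
        filter_upwards [(isOpenMap_proj M _ hO).mem_nhds ⟨w, ⟨hw, hw'⟩, rfl⟩] with x hx
        obtain ⟨a, ⟨ha, hb⟩, rfl⟩ := hx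
        rw [key a ha hb, key w hw hw'] }
  -- Points of `C₀` lift only to cusps, and `U i` contains at most one cusp.
  have hA (i : ExtendedHalfPlane) : (P.V i ∩ C₀ M).Subsingleton := by
    have hcusp (x : X₁ M) (hx : x ∈ P.V i ∩ C₀ M) : ∃ c, cusp c ∈ U i ∧ proj M (cusp c) = x := by
      obtain ⟨⟨w, hw, rfl⟩, g, hg⟩ := hx
      obtain ⟨γ, rfl⟩ := diamond_surjective M g
      obtain ⟨δ, -, hδ⟩ := proj_eq_iff.1 (hg.symm.trans (diamond_smul M γ (proj M zeroCusp)))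
      cases w with
      | cusp c => exact ⟨c, hw, rfl⟩
      | pt z => cases hδ
    rintro x hx x' hx'
    obtain ⟨c, hc, rfl⟩ := hcusp x hx
    obtain ⟨c', hc', rfl⟩ := hcusp x' hx'
    rw [(hU i).cusp_eq c c' hc hc']
  refine ⟨P.homOnRelH₁ hA, fun γ => ?_⟩
  let p := geodesic ((0 : ℚ) : OnePoint ℚ)
      (Matrix.SpecialLinearGroup.mapGL ℚ (γ : SL(2, ℤ)) • ((0 : ℚ) : OnePoint ℚ))
  have hp : P.IsPrimitive (p.map (continuous_proj M)) (h ∘ p) := by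
    rintro i s ⟨w, hw, hws⟩
    obtain ⟨δ, hδ, rfl⟩ := proj_eq_iff.1 hws
    have key (t : unitInterval) (ht : δ • p t ∈ U i) :
        (h ∘ p) t - P.h i (p.map (continuous_proj M) t) = -κ ⟨δ, hδ⟩ := by
      have : p.map (continuous_proj M) t = proj M (δ • p t) :=
        (proj_eq_iff.2 ⟨δ, hδ, rfl⟩).symm
      rw [this]
      change h (p t) - H i (proj M (δ • p t)) = _
      rw [hH i _ ht, hh ⟨δ, hδ⟩]
      abel
    have hc : Continuous fun t => δ • p t := (continuous_const_smul δ).comp p.continuous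
    filter_upwards [hc.continuousAt.eventually ((hU i).isOpen.mem_nhds hw)] with t ht
    rw [key t ht, key s hw]
  have h1 := P.homOnRelH₁_pathClass hA (p.map (continuous_proj M))
    (MulAction.mem_orbit_self _) (proj_smul_zero_mem M γ) hp
  have hp0 : p 0 = zeroCusp := p.source
  have hp1 : p 1 = (γ : SL(2, ℤ)) • zeroCusp := p.target
  rw [Function.comp_apply, Function.comp_apply, hp0, hp1] at h1
  exact h1

/-- Fixing `0` makes `γ` lower triangular, so its diagonal entries are both `1` or both `-1`. -/
theorem mem_or_neg_mem_Gamma1_of_fixes_zero {γ : SL(2, ℤ)} (hγ : γ ∈ Gamma0 M)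
    (h : γ • zeroCusp = zeroCusp) : γ ∈ Gamma1 M ∨ -γ ∈ Gamma1 M := by
  have h01 : γ 0 1 = 0 := by
    rw [smul_cusp] at h
    injection h with h
    rw [OnePoint.smul_some_eq_ite] at h
    split_ifs at h with h1
    · cases h
    · have h2 := (OnePoint.coe_injective h : _ = (0 : ℚ))
      rw [div_eq_zero_iff, or_iff_left h1] at h2
      simpa using h2
  have hdet := det_eq γ
  rw [h01, zero_mul, sub_zero] at hdet
  rw [Gamma0_mem] at hγ
  rcases Int.mul_eq_one_iff_eq_one_or_neg_one.1 hdet with ⟨h0, h1⟩ | ⟨h0, h1⟩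
  · left
    simp [Gamma1_mem, h0, h1, hγ]
  · right
    simp [Gamma1_mem, h0, h1, hγ]

theorem diamond_eq_one_of_mem_Gamma1 {γ : Gamma0 M} (h : (γ : SL(2, ℤ)) ∈ Gamma1 M) :
    diamond M γ = 1 := by
  have : (Gamma0Map M).toHomUnits γ = 1 := Units.ext ((Gamma1_mem M _).1 h).2.1
  rw [diamond, MonoidHom.comp_apply, this, map_one]

/-- A cocycle on `Γ₀(M)` that vanishes at `-1` and at the elements of `Γ₁(M)` fixing a cusp comes
from a function on `ℍ ∪ ℙ¹(ℚ)`. -/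
theorem exists_translated (hM : 3 < M) [DistribMulAction (DiamondGroup M) T] (u : Gamma0 M → T)
    (hcocycle : ∀ γ δ : Gamma0 M, u (γ * δ) = u γ + diamond M γ • u δ)
    (hneg : ∀ γ : Gamma0 M, (γ : SL(2, ℤ)) = -1 → u γ = 0)
    (hcusp : ∀ γ : Gamma0 M, (γ : SL(2, ℤ)) ∈ Gamma1 M →
      (∃ c : OnePoint ℚ, Matrix.SpecialLinearGroup.mapGL ℚ (γ : SL(2, ℤ)) • c = c) → u γ = 0) :
    ∃ h : ExtendedHalfPlane → T,
      (∀ (δ : Gamma0 M) (y), (δ : SL(2, ℤ)) ∈ Gamma1 M → h ((δ : SL(2, ℤ)) • y) = u δ + h y) ∧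
      ∀ γ : Gamma0 M, h ((γ : SL(2, ℤ)) • zeroCusp) = u γ := by
  classical
  have hmul (γ δ : Gamma0 M) (h : (γ : SL(2, ℤ)) ∈ Gamma1 M) : u (γ * δ) = u γ + u δ := by
    rw [hcocycle, diamond_eq_one_of_mem_Gamma1 h, one_smul]
  -- The stabilizer of `0` in `Γ₀(M)` lies in `±Γ₁(M)`; the sign is absorbed by `u(-1) = 0`.
  have hzero (γ : Gamma0 M) (h : (γ : SL(2, ℤ)) • zeroCusp = zeroCusp) : u γ = 0 := by
    rcases mem_or_neg_mem_Gamma1_of_fixes_zero γ.2 h with h1 | h1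
    · refine hcusp γ h1 ⟨((0 : ℚ) : OnePoint ℚ), ?_⟩
      rw [smul_cusp] at h
      injection h
    · let ν : Gamma0 M := ⟨-1, by simp [Gamma0_mem]⟩
      let γ' : Gamma0 M := ⟨-γ, Gamma1_in_Gamma0 M h1⟩
      have hγ : γ = ν * γ' := Subtype.ext (by simp [ν, γ'])
      have h2 : u γ' = 0 := by
        refine hcusp γ' h1 ⟨((0 : ℚ) : OnePoint ℚ), ?_⟩
        rw [← ExtendedHalfPlane.neg_smul, smul_cusp] at h
        injection h
      rw [hγ, hcocycle, hneg ν rfl, h2, smul_zero, add_zero]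
  -- An element of `Γ₁(M)` fixing `y` maps `y` into a good neighbourhood of `y`, hence fixes a cusp
  -- even when `y` lies in `ℍ`.
  have hstab (γ : Gamma0 M) (h1 : (γ : SL(2, ℤ)) ∈ Gamma1 M) (y : ExtendedHalfPlane)
      (hy : (γ : SL(2, ℤ)) • y = y) : u γ = 0 := by
    obtain ⟨U, α, hyU, hU⟩ := exists_isGood (M := M) hM y
    exact hcusp γ h1 (hU.exists_fixed γ h1 y hyU (by rwa [hy]))
  obtain ⟨r, hr, hrC⟩ := exists_representatives M
  have hD (y : ExtendedHalfPlane) : ∃ δ : Gamma0 M, (δ : SL(2, ℤ)) ∈ Gamma1 M ∧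
      (δ : SL(2, ℤ)) • r (proj M y) = y := by
    obtain ⟨δ, hδ, h⟩ := proj_eq_iff.1 (hr (proj M y)).symm
    exact ⟨⟨δ, Gamma1_in_Gamma0 M hδ⟩, hδ, h⟩
  choose D hD1 hDr using hD
  -- The value of `h` at the representative of each `Γ₁(M)`-orbit is free, except over `C₀`, where
  -- it must be `u(γ)` for a representative `γ0`.
  let g (x : X₁ M) : T := if hx : x ∈ C₀ M then u (hrC x hx).choose else 0
  refine ⟨fun y => u (D y) + g (proj M y), fun δ y hδ => ?_, fun γ => ?_⟩
  · have hx : proj M ((δ : SL(2, ℤ)) • y) = proj M y := proj_eq_iff.2 ⟨δ, hδ, rfl⟩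
    have h1 := hDr ((δ : SL(2, ℤ)) • y)
    rw [hx] at h1
    -- Both `D (δy)` and `δ * D y` carry the representative to `δy`, so they differ by an element of
    -- its stabilizer.
    have h2 : u ((δ * D y)⁻¹ * D ((δ : SL(2, ℤ)) • y)) = 0 := by
      refine hstab _ (mul_mem (inv_mem (mul_mem hδ (hD1 y))) (hD1 _)) (r (proj M y)) ?_
      rw [Subgroup.coe_mul, mul_smul, h1, Subgroup.coe_inv, inv_smul_eq_iff, Subgroup.coe_mul,
        mul_smul, hDr]
    have h3 : D ((δ : SL(2, ℤ)) • y) = δ * D y * ((δ * D y)⁻¹ * D ((δ : SL(2, ℤ)) • y)) := by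
      group
    change u (D _) + g (proj M _) = u δ + (u (D y) + g (proj M y))
    rw [hx, h3, hcocycle, h2, smul_zero, add_zero, hmul _ _ hδ, add_assoc]
  · have hx : proj M ((γ : SL(2, ℤ)) • zeroCusp) ∈ C₀ M := proj_smul_zero_mem M γ
    have h1 := hDr ((γ : SL(2, ℤ)) • zeroCusp)
    simp only [g, dif_pos hx]
    have h2 := (hrC _ hx).choose_spec
    generalize (hrC _ hx).choose = γ' at h2
    generalize hd : D ((γ : SL(2, ℤ)) • zeroCusp) = d at h1
    have hd1 : (d : SL(2, ℤ)) ∈ Gamma1 M := hd ▸ hD1 _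
    rw [h2] at h1
    -- Both `γ` and `d * γ'` carry `0` to the same cusp, so `u` takes the same value on them.
    have h3 : u ((d * γ')⁻¹ * γ) = 0 := by
      refine hzero _ ?_
      rw [Subgroup.coe_mul, mul_smul, ← h1, Subgroup.coe_inv, inv_smul_eq_iff, Subgroup.coe_mul,
        mul_smul]
    have h4 : γ = d * γ' * ((d * γ')⁻¹ * γ) := by group
    rw [← hmul _ _ hd1]
    conv_rhs => rw [h4, hcocycle, h3, smul_zero, add_zero]

end ModularCurve

end

/-- An abelian group with an additive action of `(ℤ/Mℤ)ˣ/{±1}` is the same thing as a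
`ℤ[(ℤ/Mℤ)ˣ/{±1}]`-module, and `→+[DiamondGroup M]` is linearity over this group ring. -/
theorem proposition3p1 (M : ℕ) (hM : 3 < M) (T : Type*) [AddCommGroup T]
    [DistribMulAction (ModularCurve.DiamondGroup M) T]
    (u : CongruenceSubgroup.Gamma0 M → T)
    (hcocycle : ∀ γ δ : CongruenceSubgroup.Gamma0 M,
      u (γ * δ) = u γ + ModularCurve.diamond M γ • u δ)
    (hneg : ∀ γ : CongruenceSubgroup.Gamma0 M, (γ : SL(2, ℤ)) = -1 → u γ = 0)
    (hcusp : ∀ γ : CongruenceSubgroup.Gamma0 M,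
      (γ : SL(2, ℤ)) ∈ CongruenceSubgroup.Gamma1 M →
      (∃ c : OnePoint ℚ, Matrix.SpecialLinearGroup.mapGL ℚ (γ : SL(2, ℤ)) • c = c) → u γ = 0) :
    ∃! v : ModularCurve.H₁ M →+[ModularCurve.DiamondGroup M] T,
      ∀ γ : CongruenceSubgroup.Gamma0 M, v (ModularCurve.zeroSymbol M γ) = u γ := by
  have hspan (c : ModularCurve.H₁ M) :
      c ∈ Submodule.span ℤ (Set.range (ModularCurve.zeroSymbol M)) := by
    rw [ModularCurve.span_zeroSymbol hM]
    trivial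
  obtain ⟨h, hh, hu⟩ := ModularCurve.exists_translated hM u hcocycle hneg hcusp
  obtain ⟨v, hv⟩ := ModularCurve.exists_hom_of_translated hM
    (fun δ => u ⟨δ, Gamma1_in_Gamma0 M δ.2⟩) h
    (fun δ hδ => hcusp ⟨δ, Gamma1_in_Gamma0 M δ.2⟩ δ.2 hδ)
    (fun δ y => hh ⟨δ, Gamma1_in_Gamma0 M δ.2⟩ y δ.2)
  have hu1 : u 1 = 0 := by
    have := hcocycle 1 1
    rwa [map_one, one_smul, one_mul, left_eq_add] at this
  have hvu (γ : Gamma0 M) : v (ModularCurve.zeroSymbol M γ) = u γ := by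
    have h1 := hu 1
    rw [hu1, Subgroup.coe_one, one_smul] at h1
    rw [hv, hu, h1, sub_zero]
  have hequiv (g : ModularCurve.DiamondGroup M) (c : ModularCurve.H₁ M) :
      v (g • c) = g • v c := by
    obtain ⟨γ, rfl⟩ := ModularCurve.diamond_surjective M g
    induction hspan c using Submodule.span_induction with
    | mem _ hc =>
      obtain ⟨δ, rfl⟩ := hc
      -- On a generator, `γ{0, δ0} = {0, γδ0} - {0, γ0}`, and the cocycle relation for `u` is
      -- exactly the required equivariance.
      have h1 := eq_sub_of_add_eq' (ModularCurve.zeroSymbol_mul M γ δ).symm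
      rw [h1, map_sub, hvu, hvu, hvu, hcocycle, add_sub_cancel_left]
    | zero => rw [smul_zero, map_zero, smul_zero]
    | add a b _ _ ha hb => rw [smul_add, map_add, ha, hb, map_add, smul_add]
    | smul k a _ ha => rw [smul_comm, map_smul, ha, map_smul, smul_comm]
  refine ⟨⟨⟨v, hequiv⟩, map_zero v, map_add v⟩, hvu, fun w hw => ?_⟩
  refine DistribMulActionHom.ext fun c => ?_
  change w c = v c
  induction hspan c using Submodule.span_induction with
  | mem _ hc =>
    obtain ⟨δ, rfl⟩ := hc
    rw [hw, hvu]
  | zero => rw [map_zero, map_zero]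
  | add a b _ _ ha hb => rw [map_add, map_add, ha, hb]
  | smul k a _ ha => rw [map_zsmul, map_smul, ha]
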